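/- An instance of fair correlation clustering consists of a complete graph on a finite vertex set $V$, $|V|=n$, each of whose edges is labelled $+$ or $-$, and a colour $c(v)$ for every vertex $v$. Write $E^+$, $E^-$ for the sets of positive and negative edges. For $\alpha\in(0,1]$, a partition $\mathcal P$ of $V$ into nonempty sets is *fair* if every $S\in\mathcal P$ contains at most $\alpha|S|$ vertices of each colour. *Fair correlation clustering* asks for a fair partition $\mathcal C$ minimizing $\mathrm{cost}(\mathcal C)$, the number of negative edges inside the sets of $\mathcal C$ plus the number of positive edges between different sets of $\mathcal C$. *Fairlet decomposition with median cost* asks for a fair partition $\mathcal P$ minimizing $$\mathrm{mcost}(\mathcal P)=\sum_{S\in\mathcal P}\ \min_{x\in[0,1]^V}\ \sum_{v\in S}\ \sum_{u\in V}|x_u-\phi(v)_u|,$$ where $\phi(v)_u=1$ if $u=v$ or $\{u,v\}\in E^+$, and $\phi(v)_u=0$ otherwise. An algorithm is a (deterministic) program for a unit-cost random access machine whose arithmetic operations are addition and truncated subtraction, with read access to the instance. It is a $\rho$-approximation algorithm for one of these problems, with running time at most $T$, if it halts on every instance $I$ within $T(I)$ steps and, whenever $I$ has a fair partition, outputs a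 fair partition whose cost is at most $\rho$ times the cost of every fair partition. **Theorem.** There are an absolute constant $K$ and a polynomial $q$ such that the following holds for every integer $t\ge 1$, with $\alpha=1/t$, every real $\gamma\ge 1$ and every time bound $T$: given a $\gamma$-approximation algorithm for fairlet decomposition with median cost, with running time at most $T(I)$, there is a $K t\gamma$-approximation algorithm for fair correlation clustering with running time at most $T(I)+q(n)$ on instances $I$ with $n$ vertices. (In particular, if the given algorithm runs in polynomial time, then so does the resulting $O(t\gamma)$-approximation algorithm.) -/

import Mathlib

/-! ### Fair correlation clustering -/

/-- An instance of (unweighted) correlation clustering with coloured vertices: the complete graph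
on `Fin n`, whose edges are labelled `+` or `-`, and a colour for every vertex.  The graph `pos`
consists of the edges labelled `+`, so `posᶜ` consists of the edges labelled `-`. -/
structure CCInstance where
  n : ℕ
  pos : SimpleGraph (Fin n)
  color : Fin n → ℕ

namespace CCInstance

/-- A clustering (also: a fairlet decomposition) is a partition of the vertex set. -/
abbrev Clustering (I : CCInstance) : Type := Finpartition (Finset.univ : Finset (Fin I.n))

/-- A set of vertices is fair for `α` if every colour makes up at most an `α`-fraction of it. -/
def IsFairSet (I : CCInstance) (α : ℝ) (S : Finset (Fin I.n)) : Prop :=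
  ∀ k : ℕ, ((S.filter fun v => I.color v = k).card : ℝ) ≤ α * (S.card : ℝ)

/-- All parts are fair: a fair clustering, equivalently a fairlet decomposition. -/
def IsFair (I : CCInstance) (α : ℝ) (P : I.Clustering) : Prop :=
  ∀ S ∈ P.parts, I.IsFairSet α S

/-- The edge `e` has both endpoints in the same cluster. -/
def IsIntra (I : CCInstance) (P : I.Clustering) (e : Sym2 (Fin I.n)) : Prop :=
  ∃ S ∈ P.parts, ∀ v ∈ e, v ∈ S

/-- The correlation clustering cost: the number of negative edges inside clusters plus the number
of positive edges between clusters. -/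
noncomputable def ccCost (I : CCInstance) (P : I.Clustering) : ℝ :=
  ({e | e ∈ I.posᶜ.edgeSet ∧ I.IsIntra P e}.ncard : ℝ) +
    ({e | e ∈ I.pos.edgeSet ∧ ¬ I.IsIntra P e}.ncard : ℝ)

/-- The cube `[0,1]ⁿ`. -/
abbrev Cube (I : CCInstance) : Type := Fin I.n → Set.Icc (0 : ℝ) 1

/-- The distance `|x - y| = ∑ v, |x_v - y_v|` on the cube. -/
noncomputable def cubeDist (I : CCInstance) (x y : I.Cube) : ℝ :=
  ∑ v, |(x v : ℝ) - (y v : ℝ)|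

open Classical in
/-- The embedding of the vertices into the cube: row `u` of the adjacency matrix of the positive
graph, with a positive loop added at every vertex. -/
noncomputable def embed (I : CCInstance) (u : Fin I.n) : I.Cube :=
  fun v => if u = v ∨ I.pos.Adj u v then 1 else 0

/-- The median cost of a single set, `min_x ∑_{v ∈ S} d(x, v)` over all points of the cube. -/
noncomputable def medianCostSet (I : CCInstance) (S : Finset (Fin I.n)) : ℝ :=
  ⨅ x : I.Cube, ∑ v ∈ S, I.cubeDist x (I.embed v)

/-- The median cost of a fairlet decomposition. -/
noncomputable def medianCost (I : CCInstance) (P : I.Clustering) : ℝ :=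
  ∑ S ∈ P.parts, I.medianCostSet S

end CCInstance

/-! ### Algorithms

Algorithms are programs of a small imperative language: a random access machine on natural
numbers, with registers and finitely many two-dimensional arrays, read access to the instance, and
addition and truncated subtraction as its only arithmetic.  Every operation costs one step. -/

/-- Expressions. -/
inductive RamExpr : Type
  | const (k : ℕ)
  | reg (x : ℕ)
  | load (a : ℕ) (i j : RamExpr)
  | numVertices
  | adj (i j : RamExpr)
  | color (i : RamExpr)
  | add (e f : RamExpr)
  | sub (e f : RamExpr)
  | lt (e f : RamExpr)
  | eq (e f : RamExpr)

/-- Programs.  Conditions count as true when they are nonzero. -/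
inductive RamProg : Type
  | skip
  | assign (x : ℕ) (e : RamExpr)
  | store (a : ℕ) (i j e : RamExpr)
  | seq (p q : RamProg)
  | ite (e : RamExpr) (p q : RamProg)
  | while (e : RamExpr) (p : RamProg)

/-- The working memory: registers `reg x` and arrays `mem a`, with entries `mem a i j`. -/
structure RamState where
  reg : ℕ → ℕ
  mem : ℕ → ℕ → ℕ → ℕ

namespace RamState

/-- The initial memory, all of it zero. -/
def init : RamState := ⟨fun _ => 0, fun _ _ _ => 0⟩

def setReg (s : RamState) (x v : ℕ) : RamState :=
  { s with reg := fun y => if y = x then v else s.reg y }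

def setMem (s : RamState) (a i j v : ℕ) : RamState :=
  { s with mem := fun a' i' j' => if a' = a ∧ i' = i ∧ j' = j then v else s.mem a' i' j' }

open Classical in
/-- The clustering that a memory describes: the entry `mem 0 v 0` is the label of the vertex `v`,
and two vertices are in the same cluster when their labels agree. -/
noncomputable def output (I : CCInstance) (s : RamState) : I.Clustering :=
  Finpartition.ofSetoid (Setoid.ker fun v : Fin I.n => s.mem 0 v 0)

end RamState

namespace RamExpr

open Classical in
/-- The value of an expression.  Reading the instance outside its range gives `0`. -/
noncomputable def eval (I : CCInstance) (s : RamState) : RamExpr → ℕ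
  | const k => k
  | reg x => s.reg x
  | load a i j => s.mem a (i.eval I s) (j.eval I s)
  | numVertices => I.n
  | adj i j =>
      if ∃ u v : Fin I.n, (u : ℕ) = i.eval I s ∧ (v : ℕ) = j.eval I s ∧ I.pos.Adj u v then 1 else 0
  | color i => if h : i.eval I s < I.n then I.color ⟨i.eval I s, h⟩ else 0
  | add e f => e.eval I s + f.eval I s
  | sub e f => e.eval I s - f.eval I s
  | lt e f => if e.eval I s < f.eval I s then 1 else 0
  | eq e f => if e.eval I s = f.eval I s then 1 else 0

/-- The number of steps that the evaluation of an expression takes: its number of operations. -/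
def cost : RamExpr → ℕ
  | const _ => 1
  | reg _ => 1
  | load _ i j => i.cost + j.cost + 1
  | numVertices => 1
  | adj i j => i.cost + j.cost + 1
  | color i => i.cost + 1
  | add e f => e.cost + f.cost + 1
  | sub e f => e.cost + f.cost + 1
  | lt e f => e.cost + f.cost + 1
  | eq e f => e.cost + f.cost + 1

end RamExpr

/-- `RamExec I p s s' k`: on the instance `I`, the program `p` started with the memory `s` halts
after `k` steps with the memory `s'`. -/
inductive RamExec (I : CCInstance) : RamProg → RamState → RamState → ℕ → Prop
  | skip (s : RamState) : RamExec I .skip s s 1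
  | assign (x : ℕ) (e : RamExpr) (s : RamState) :
      RamExec I (.assign x e) s (s.setReg x (e.eval I s)) (e.cost + 1)
  | store (a : ℕ) (i j e : RamExpr) (s : RamState) :
      RamExec I (.store a i j e) s (s.setMem a (i.eval I s) (j.eval I s) (e.eval I s))
        (i.cost + j.cost + e.cost + 1)
  | seq {p q : RamProg} {s s' s'' : RamState} {k l : ℕ} :
      RamExec I p s s' k → RamExec I q s' s'' l → RamExec I (.seq p q) s s'' (k + l)
  | iteTrue {e : RamExpr} {p q : RamProg} {s s' : RamState} {k : ℕ} :
      e.eval I s ≠ 0 → RamExec I p s s' k → RamExec I (.ite e p q) s s' (e.cost + 1 + k)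
  | iteFalse {e : RamExpr} {p q : RamProg} {s s' : RamState} {k : ℕ} :
      e.eval I s = 0 → RamExec I q s s' k → RamExec I (.ite e p q) s s' (e.cost + 1 + k)
  | whileTrue {e : RamExpr} {p : RamProg} {s s' s'' : RamState} {k l : ℕ} :
      e.eval I s ≠ 0 → RamExec I p s s' k → RamExec I (.while e p) s' s'' l →
        RamExec I (.while e p) s s'' (e.cost + 1 + k + l)
  | whileFalse {e : RamExpr} {p : RamProg} {s : RamState} :
      e.eval I s = 0 → RamExec I (.while e p) s s (e.cost + 1)

/-- The program `A` is a `ρ`-approximation algorithm, with running time at most `T`, for the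
problem of finding a partition into sets that are fair for `α` of minimum cost `obj`: it halts on
every instance `I` within `T I` steps, and if `I` has a feasible solution at all, then its output is
feasible, of cost at most `ρ` times the cost of every feasible solution. -/
def IsFairApproxAlgorithm (α : ℝ) (obj : (I : CCInstance) → I.Clustering → ℝ) (ρ : ℝ)
    (A : RamProg) (T : CCInstance → ℕ) : Prop :=
  ∀ I : CCInstance, ∃ (s : RamState) (k : ℕ), RamExec I A RamState.init s k ∧ k ≤ T I ∧
    ((∃ Q : I.Clustering, I.IsFair α Q) →
      I.IsFair α (s.output I) ∧
        ∀ Q : I.Clustering, I.IsFair α Q → obj I (s.output I) ≤ ρ * obj I Q)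

/-- A `γ`-approximation algorithm for fairlet decomposition with median cost. -/
def IsMedianFairletApproxAlgorithm (α γ : ℝ) (A : RamProg) (T : CCInstance → ℕ) : Prop :=
  IsFairApproxAlgorithm α CCInstance.medianCost γ A T

/-- A `ρ`-approximation algorithm for fair correlation clustering. -/
def IsFairCCApproxAlgorithm (α ρ : ℝ) (A : RamProg) (T : CCInstance → ℕ) : Prop :=
  IsFairApproxAlgorithm α CCInstance.ccCost ρ A T

/-! Run the given algorithm, split each of its clusters into fairlets of between `t` and `2t`
vertices in which no colour repeats, and cluster these fairlets as indivisible blocks. Any union of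
such fairlets is fair (`IsFairLabelling.coarsen`): each vertex of a given colour brings its own
fairlet of at least `t` vertices.

To cluster the blocks, replace the positive graph by the majority graph, which is constant between
blocks and complete inside them. Its distance from the positive graph is controlled by the distances
between adjacency rows inside blocks (`sum_majority_ne_le`). By the triangle inequality through a
median, these row distances are at most `4t` times the median cost of the given decomposition
(`blockDist_le_medianCost`). Conversely, the indicator of a cluster is a candidate median, so the
median cost of any partition is at most twice its correlation clustering cost (`medianCost_le`).

It remains to approximate unrestricted correlation clustering on the majority graph within a
constant factor, keeping every block together. A greedy packing of bad triangles gives a lower bound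
on the errors of every labelling, and a derandomized pivot algorithm charges its errors to the
packing, for a ratio of 9 (`run_pack_pivot`). Vertices of one block have equal rows, and pivoting
gives such twins the same label. Moving from the positive graph to the majority graph and back costs
an additive multiple of their distance (`matrixErrors_le`), which yields a total factor of order
`tγ`.

All of this is written in a language of loops over the vertices. Such programs halt in polynomial
time on every memory, hence also when the given algorithm returns no fair partition, and they
compile to the machine without a dependence of the time bound on `t`. -/

/-! ### A language with bounded loops

Programs whose only loops run a counter through the vertices.  They halt within polynomially many
steps on every instance, and compile to programs of the random access machine. -/

/-- Working arrays. -/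
abbrev Memory : Type := ℕ → ℕ → ℕ → ℕ

/-- Replace one entry of an array. -/
def Memory.set (m : Memory) (a i j v : ℕ) : Memory :=
  fun a' i' j' => if a' = a ∧ i' = i ∧ j' = j then v else m a' i' j'

/-- Binary operations (`color` ignores its second argument). -/
inductive BinOp : Type
  | add | sub | lt | eq | adj | color
  | load (a : ℕ)

namespace BinOp

def toRam : BinOp → RamExpr → RamExpr → RamExpr
  | add, e, f => .add e f
  | sub, e, f => .sub e f
  | lt, e, f => .lt e f
  | eq, e, f => .eq e f
  | adj, e, f => .adj e f
  | color, e, _ => .color e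
  | load a, e, f => .load a e f

noncomputable def eval (I : CCInstance) (m : Memory) (o : BinOp) (a b : ℕ) : ℕ :=
  (o.toRam (.const a) (.const b)).eval I ⟨fun _ => 0, m⟩

theorem eval_toRam (I : CCInstance) (s : RamState) (o : BinOp) (e f : RamExpr) :
    (o.toRam e f).eval I s = o.eval I s.mem (e.eval I s) (f.eval I s) := by
  cases o <;> rfl

theorem cost_toRam_le (o : BinOp) (e f : RamExpr) :
    (o.toRam e f).cost ≤ e.cost + f.cost + 1 := by
  cases o <;> simp [toRam, RamExpr.cost]

theorem eval_add (I : CCInstance) (m : Memory) (a b : ℕ) : add.eval I m a b = a + b := rfl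

theorem eval_sub (I : CCInstance) (m : Memory) (a b : ℕ) : sub.eval I m a b = a - b := rfl

theorem eval_lt (I : CCInstance) (m : Memory) (a b : ℕ) :
    lt.eval I m a b = if a < b then 1 else 0 := if_congr Iff.rfl rfl rfl

theorem eval_eq (I : CCInstance) (m : Memory) (a b : ℕ) :
    eq.eval I m a b = if a = b then 1 else 0 := if_congr Iff.rfl rfl rfl

theorem eval_load (I : CCInstance) (m : Memory) (x a b : ℕ) :
    (load x).eval I m a b = m x a b := rfl

open Classical in
theorem eval_adj (I : CCInstance) (m : Memory) (u v : Fin I.n) :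
    adj.eval I m u v = if I.pos.Adj u v then 1 else 0 := by
  refine if_congr ⟨?_, fun h => ⟨u, v, rfl, rfl, h⟩⟩ rfl rfl
  rintro ⟨u', v', hu, hv, h⟩
  rwa [← Fin.ext hu, ← Fin.ext hv]

theorem eval_color (I : CCInstance) (m : Memory) (u : Fin I.n) (b : ℕ) :
    color.eval I m u b = I.color u := dif_pos u.2

end BinOp

/-- Expressions with sums over the vertices. -/
inductive LoopExpr : Type
  | const (k : ℕ)
  | var (x : ℕ)
  | num
  | bin (o : BinOp) (e f : LoopExpr)
  | ite (c e f : LoopExpr)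
  | sum (x : ℕ) (e : LoopExpr)

namespace LoopExpr

noncomputable def eval (I : CCInstance) (m : Memory) : LoopExpr → (ℕ → ℕ) → ℕ
  | const k, _ => k
  | var x, r => r x
  | num, _ => I.n
  | bin o e f, r => o.eval I m (e.eval I m r) (f.eval I m r)
  | ite c e f, r => if c.eval I m r ≠ 0 then e.eval I m r else f.eval I m r
  | sum x e, r => ∑ i ∈ Finset.range I.n, e.eval I m (Function.update r x i)

/-- A number above all variables. -/
def bound : LoopExpr → ℕ
  | const _ => 0
  | var x => x + 1
  | num => 0
  | bin _ e f => max e.bound f.bound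
  | ite c e f => max c.bound (max e.bound f.bound)
  | sum x e => max (x + 1) e.bound

/-- The code for an expression leaves its value in the register `d`, and changes no register
below `d`. -/
def compile : LoopExpr → ℕ → RamProg
  | const k, d => .assign d (.const k)
  | var x, d => .assign d (.reg x)
  | num, d => .assign d .numVertices
  | bin o e f, d =>
      .seq (e.compile d) (.seq (f.compile (d + 1)) (.assign d (o.toRam (.reg d) (.reg (d + 1)))))
  | ite c e f, d =>
      .seq (c.compile d) (.seq (e.compile (d + 1)) (.seq (f.compile (d + 2))
        (.ite (.reg d) (.assign d (.reg (d + 1))) (.assign d (.reg (d + 2))))))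
  | sum x e, d =>
      .seq (.assign d (.const 0)) (.seq (.assign (d + 1) (.reg x)) (.seq (.assign x (.const 0))
        (.seq (.while (.lt (.reg x) .numVertices)
          (.seq (e.compile (d + 2)) (.seq (.assign d (.add (.reg d) (.reg (d + 2))))
            (.assign x (.add (.reg x) (.const 1))))))
          (.assign x (.reg (d + 1))))))

/-- A bound for the running time of the code, as a polynomial in the number of vertices. -/
noncomputable def cost : LoopExpr → Polynomial ℕ
  | const _ => 2
  | var _ => 2
  | num => 2
  | bin _ e f => e.cost + f.cost + 4
  | ite c e f => c.cost + e.cost + f.cost + 4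
  | sum _ e => Polynomial.X * (e.cost + 12) + 12

/-- Registers from `bound` on are free for intermediate results: changing them cannot affect the
value. -/
theorem eval_congr (I : CCInstance) (m : Memory) :
    ∀ (e : LoopExpr) (r r' : ℕ → ℕ), (∀ x < e.bound, r x = r' x) → e.eval I m r = e.eval I m r'
  | const _, _, _, _ => rfl
  | var x, _, _, h => h x (Nat.lt_succ_self x)
  | num, _, _, _ => rfl
  | bin o e f, r, r', h => by
      simp only [bound] at h
      rw [eval, eval, eval_congr I m e r r' fun x hx => h x (by omega),
        eval_congr I m f r r' fun x hx => h x (by omega)]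
  | ite c e f, r, r', h => by
      simp only [bound] at h
      rw [eval, eval, eval_congr I m c r r' fun x hx => h x (by omega),
        eval_congr I m e r r' fun x hx => h x (by omega),
        eval_congr I m f r r' fun x hx => h x (by omega)]
  | sum x e, r, r', h => by
      simp only [bound] at h
      rw [eval, eval]
      refine Finset.sum_congr rfl fun i _ => eval_congr I m e _ _ fun y hy => ?_
      by_cases hyx : y = x
      · simp [hyx]
      · simp [hyx, h y (by omega)]

end LoopExpr

namespace RamExec

/-- Rule for a loop that runs the register `x` from `0` to the number of vertices. -/
theorem while_lt (I : CCInstance) (x c : ℕ) (p : RamProg) (Q : ℕ → RamState → Prop)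
    (hx : ∀ i s, Q i s → s.reg x = i)
    (hp : ∀ i < I.n, ∀ s, Q i s → ∃ s' k, RamExec I p s s' k ∧ k ≤ c ∧ Q (i + 1) s')
    (s : RamState) (hs : Q 0 s) :
    ∃ s' k, RamExec I (.while (.lt (.reg x) .numVertices) p) s s' k ∧
      k ≤ I.n * (c + 4) + 4 ∧ Q I.n s' := by
  -- Induction on the number `j` of remaining iterations; each test of the loop condition takes 4
  -- steps.
  have key : ∀ j i s, i + j = I.n → Q i s →
      ∃ s' k, RamExec I (.while (.lt (.reg x) .numVertices) p) s s' k ∧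
        k ≤ j * (c + 4) + 4 ∧ Q I.n s' := by
    intro j
    induction j with
    | zero =>
      intro i s hi hq
      obtain rfl : i = I.n := by omega
      refine ⟨s, _, .whileFalse ?_, ?_, hq⟩
      · simp [RamExpr.eval, hx _ _ hq]
      · simp [RamExpr.cost]
    | succ j ih =>
      intro i s hi hq
      obtain ⟨s₁, k, he, hk, hq₁⟩ := hp i (by omega) s hq
      obtain ⟨s₂, l, hl, hlk, hq₂⟩ := ih (i + 1) s₁ (by omega) hq₁
      refine ⟨s₂, _, .whileTrue ?_ he hl, ?_, hq₂⟩
      · have : i < I.n := by omega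
        simp [RamExpr.eval, hx _ _ hq, this]
      · simp only [RamExpr.cost]
        linarith
  exact key I.n 0 s (by omega) hs

end RamExec

theorem RamState.reg_setReg (s : RamState) (x v y : ℕ) :
    (s.setReg x v).reg y = if y = x then v else s.reg y := rfl

theorem RamState.mem_setReg (s : RamState) (x v : ℕ) : (s.setReg x v).mem = s.mem := rfl

/-! ### Correctness and running time of compiled expressions -/

namespace LoopExpr

/-- Structural induction. Code placed at `d + 1` or `d + 2` preserves the intermediate values stored
below it, so subexpressions can be evaluated one after the other. No hypothesis on the memory is
needed, so halting is unconditional. -/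
theorem exec_compile (I : CCInstance) : ∀ (e : LoopExpr) (d : ℕ) (s : RamState), e.bound ≤ d →
    ∃ s' k, RamExec I (e.compile d) s s' k ∧ k ≤ e.cost.eval I.n ∧ s'.mem = s.mem ∧
      (∀ x < d, s'.reg x = s.reg x) ∧ s'.reg d = e.eval I s.mem s.reg
  | const k, d, s, _ => ⟨_, _, .assign _ _ _, by simp [cost, RamExpr.cost], rfl,
      fun x hx => by simp [RamState.reg_setReg, hx.ne], by
        simp [RamState.reg_setReg, RamExpr.eval, eval]⟩
  | var x, d, s, _ => ⟨_, _, .assign _ _ _, by simp [cost, RamExpr.cost], rfl,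
      fun x hx => by simp [RamState.reg_setReg, hx.ne], by
        simp [RamState.reg_setReg, RamExpr.eval, eval]⟩
  | num, d, s, _ => ⟨_, _, .assign _ _ _, by simp [cost, RamExpr.cost], rfl,
      fun x hx => by simp [RamState.reg_setReg, hx.ne], by
        simp [RamState.reg_setReg, RamExpr.eval, eval]⟩
  | bin o e f, d, s, h => by
      simp only [bound] at h
      obtain ⟨s₁, k₁, h₁, hk₁, hm₁, hr₁, hv₁⟩ := exec_compile I e d s (by omega)
      obtain ⟨s₂, k₂, h₂, hk₂, hm₂, hr₂, hv₂⟩ := exec_compile I f (d + 1) s₁ (by omega)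
      refine ⟨_, _, .seq h₁ (.seq h₂ (.assign _ _ _)), ?_, ?_, fun x hx => ?_, ?_⟩
      · have := o.cost_toRam_le (.reg d) (.reg (d + 1))
        simp only [RamExpr.cost] at this
        simp only [cost, Polynomial.eval_add, Polynomial.eval_ofNat]
        omega
      · rw [RamState.mem_setReg, hm₂, hm₁]
      · rw [RamState.reg_setReg, if_neg hx.ne, hr₂ x (by omega), hr₁ x hx]
      · rw [RamState.reg_setReg, if_pos rfl, BinOp.eval_toRam, hm₂, hm₁, RamExpr.eval,
          RamExpr.eval, hv₂, hr₂ d (by omega), hv₁, hm₁, eval,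
          eval_congr I s.mem f s₁.reg s.reg fun x hx => hr₁ x (by omega)]
  | ite c e f, d, s, h => by
      simp only [bound] at h
      obtain ⟨s₁, k₁, h₁, hk₁, hm₁, hr₁, hv₁⟩ := exec_compile I c d s (by omega)
      obtain ⟨s₂, k₂, h₂, hk₂, hm₂, hr₂, hv₂⟩ := exec_compile I e (d + 1) s₁ (by omega)
      obtain ⟨s₃, k₃, h₃, hk₃, hm₃, hr₃, hv₃⟩ := exec_compile I f (d + 2) s₂ (by omega)
      have e₂ : s₃.reg (d + 1) = e.eval I s.mem s.reg := by
        rw [hr₃ _ (by omega), hv₂, hm₁,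
          eval_congr I s.mem e s₁.reg s.reg fun x hx => hr₁ x (by omega)]
      have e₃ : s₃.reg (d + 2) = f.eval I s.mem s.reg := by
        rw [hv₃, hm₂, hm₁, eval_congr I s.mem f s₂.reg s.reg fun x hx => by
          rw [hr₂ x (by omega), hr₁ x (by omega)]]
      have e₁ : s₃.reg d = c.eval I s.mem s.reg := by
        rw [hr₃ _ (by omega), hr₂ _ (by omega), hv₁]
      by_cases hc : c.eval I s.mem s.reg = 0
      · refine ⟨_, _, .seq h₁ (.seq h₂ (.seq h₃ (.iteFalse (by simpa [RamExpr.eval, e₁])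
          (.assign _ _ _)))), ?_, ?_, fun x hx => ?_, ?_⟩
        · simp only [cost, RamExpr.cost, Polynomial.eval_add, Polynomial.eval_ofNat]
          omega
        · rw [RamState.mem_setReg, hm₃, hm₂, hm₁]
        · rw [RamState.reg_setReg, if_neg hx.ne, hr₃ x (by omega), hr₂ x (by omega), hr₁ x hx]
        · simp [RamState.reg_setReg, RamExpr.eval, e₃, eval, hc]
      · refine ⟨_, _, .seq h₁ (.seq h₂ (.seq h₃ (.iteTrue (by simpa [RamExpr.eval, e₁])
          (.assign _ _ _)))), ?_, ?_, fun x hx => ?_, ?_⟩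
        · simp only [cost, RamExpr.cost, Polynomial.eval_add, Polynomial.eval_ofNat]
          omega
        · rw [RamState.mem_setReg, hm₃, hm₂, hm₁]
        · rw [RamState.reg_setReg, if_neg hx.ne, hr₃ x (by omega), hr₂ x (by omega), hr₁ x hx]
        · simp [RamState.reg_setReg, RamExpr.eval, e₂, eval, hc]
  | sum x e, d, s, h => by
      simp only [bound] at h
      -- Loop invariant: `d` holds the partial sum and `d + 1` the old value of the bound variable
      -- `x`, which lies below `d` and has to be restored at the end.
      let Q : ℕ → RamState → Prop := fun i s' => s'.mem = s.mem ∧ s'.reg x = i ∧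
        (∀ y < d, y ≠ x → s'.reg y = s.reg y) ∧ s'.reg (d + 1) = s.reg x ∧
        s'.reg d = ∑ j ∈ Finset.range i, e.eval I s.mem (Function.update s.reg x j)
      obtain ⟨s₁, k₁, h₁, hk₁, hm₁, hx₁, hr₁, hs₁, hv₁⟩ := RamExec.while_lt I x
        (e.cost.eval I.n + 8)
        (.seq (e.compile (d + 2)) (.seq (.assign d (.add (.reg d) (.reg (d + 2))))
            (.assign x (.add (.reg x) (.const 1))))) Q (fun _ _ hq => hq.2.1)
        (fun i hi s' hq => by
          obtain ⟨hm, hx, hr, hs, hv⟩ := hq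
          obtain ⟨s₂, k₂, h₂, hk₂, hm₂, hr₂, hv₂⟩ := exec_compile I e (d + 2) s' (by omega)
          refine ⟨_, _, .seq h₂ (.seq (.assign _ _ _) (.assign _ _ _)), ?_, ?_, ?_, ?_, ?_, ?_⟩
          · simp only [RamExpr.cost]
            omega
          · rw [RamState.mem_setReg, RamState.mem_setReg, hm₂, hm]
          · have : x ≠ d := by omega
            simp [RamState.reg_setReg, RamExpr.eval, this, hr₂ x (by omega), hx]
          · intro y hy hyx
            rw [RamState.reg_setReg, if_neg hyx, RamState.reg_setReg, if_neg hy.ne,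
              hr₂ y (by omega), hr y hy hyx]
          · have : d + 1 ≠ x := by omega
            simp [RamState.reg_setReg, this, hr₂ (d + 1) (by omega), hs]
          · have : d ≠ x := by omega
            rw [RamState.reg_setReg, if_neg this, RamState.reg_setReg, if_pos rfl, RamExpr.eval,
              RamExpr.eval, RamExpr.eval, hr₂ d (by omega), hv, hv₂, hm, Finset.sum_range_succ]
            congr 1
            refine eval_congr I s.mem e _ _ fun y hy => ?_
            by_cases hyx : y = x
            · simp [hyx, hx]
            · simp [hyx, hr y (by omega) hyx])
        (((s.setReg d 0).setReg (d + 1) (s.reg x)).setReg x 0) (by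
          have h1 : d ≠ x := by omega
          have h2 : d + 1 ≠ x := by omega
          refine ⟨rfl, ?_, fun y hy hyx => ?_, ?_, ?_⟩
          · simp [RamState.reg_setReg]
          · have h3 : y ≠ d + 1 := by omega
            simp [RamState.reg_setReg, hyx, hy.ne, h3]
          · simp [RamState.reg_setReg, h2]
          · simp [RamState.reg_setReg, h1])
      have h1 : x ≠ d := by omega
      refine ⟨_, _, .seq (.assign _ _ _) (.seq (.assign _ _ _) (.seq (.assign _ _ _) (.seq
        (s := RamState.setReg _ _ _) (s' := s₁) (k := k₁) ?_ (.assign _ _ _)))),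
        ?_, ?_, fun y hy => ?_, ?_⟩
      · convert h₁ using 1
        simp [RamExpr.eval, RamState.reg_setReg, h1]
      · simp only [cost, RamExpr.cost, Polynomial.eval_add, Polynomial.eval_mul, Polynomial.eval_X,
          Polynomial.eval_ofNat]
        rw [show e.cost.eval I.n + 8 + 4 = e.cost.eval I.n + 12 from rfl] at hk₁
        omega
      · rw [RamState.mem_setReg, hm₁]
      · by_cases hyx : y = x
        · simp [RamState.reg_setReg, hyx, RamExpr.eval, hs₁]
        · simp [RamState.reg_setReg, hyx, hr₁ y hy hyx]
      · simp [RamState.reg_setReg, h1.symm, hv₁, eval]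

end LoopExpr

/-- Perform `f 0`, …, `f (n - 1)` one after the other. -/
def forLoop {M : Type*} (n : ℕ) (f : ℕ → M → M) (m : M) : M :=
  Nat.rec m (fun i m' => f i m') n

theorem forLoop_succ {M : Type*} (n : ℕ) (f : ℕ → M → M) (m : M) :
    forLoop (n + 1) f m = f n (forLoop n f m) := rfl

theorem forLoop_induction {M : Type*} {n : ℕ} {f : ℕ → M → M} {m : M} (Q : ℕ → M → Prop)
    (h0 : Q 0 m) (h : ∀ i < n, ∀ m', Q i m' → Q (i + 1) (f i m')) : Q n (forLoop n f m) := by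
  have : ∀ i ≤ n, Q i (forLoop i f m) := by
    intro i
    induction i with
    | zero => exact fun _ => h0
    | succ i ih => exact fun hi => h i hi _ (ih (by omega))
  exact this n le_rfl

/-- Programs with loops over the vertices. -/
inductive LoopProg : Type
  | store (a : ℕ) (i j e : LoopExpr)
  | seq (p q : LoopProg)
  | ite (e : LoopExpr) (p : LoopProg)
  | for (x : ℕ) (p : LoopProg)

namespace LoopProg

/-- The effect of a program on the memory. -/
noncomputable def run (I : CCInstance) : LoopProg → (ℕ → ℕ) → Memory → Memory
  | store a i j e, r, m => m.set a (i.eval I m r) (j.eval I m r) (e.eval I m r)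
  | seq p q, r, m => q.run I r (p.run I r m)
  | ite e p, r, m => if e.eval I m r ≠ 0 then p.run I r m else m
  | .for x p, r, m => forLoop I.n (fun i => p.run I (Function.update r x i)) m

def bound : LoopProg → ℕ
  | store _ i j e => max i.bound (max j.bound e.bound)
  | seq p q => max p.bound q.bound
  | ite e p => max e.bound p.bound
  | .for x p => max (x + 1) p.bound

def compile : LoopProg → ℕ → RamProg
  | store a i j e, d =>
      .seq (i.compile d) (.seq (j.compile (d + 1)) (.seq (e.compile (d + 2))
        (.store a (.reg d) (.reg (d + 1)) (.reg (d + 2)))))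
  | seq p q, d => .seq (p.compile d) (q.compile d)
  | ite e p, d => .seq (e.compile d) (.ite (.reg d) (p.compile d) .skip)
  | .for x p, d =>
      .seq (.assign d (.reg x)) (.seq (.assign x (.const 0))
        (.seq (.while (.lt (.reg x) .numVertices)
          (.seq (p.compile (d + 1)) (.assign x (.add (.reg x) (.const 1)))))
          (.assign x (.reg d))))

noncomputable def cost : LoopProg → Polynomial ℕ
  | store _ i j e => i.cost + j.cost + e.cost + 4
  | seq p q => p.cost + q.cost
  | ite e p => e.cost + p.cost + 3
  | .for _ p => Polynomial.X * (p.cost + 8) + 10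

theorem run_congr (I : CCInstance) :
    ∀ (p : LoopProg) (r r' : ℕ → ℕ) (m : Memory), (∀ x < p.bound, r x = r' x) →
      p.run I r m = p.run I r' m
  | store a i j e, r, r', m, h => by
      simp only [bound] at h
      rw [run, run, i.eval_congr I m r r' fun x hx => h x (by omega),
        j.eval_congr I m r r' fun x hx => h x (by omega),
        e.eval_congr I m r r' fun x hx => h x (by omega)]
  | seq p q, r, r', m, h => by
      simp only [bound] at h
      rw [run, run, run_congr I p r r' m fun x hx => h x (by omega),
        run_congr I q r r' _ fun x hx => h x (by omega)]
  | ite e p, r, r', m, h => by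
      simp only [bound] at h
      rw [run, run, e.eval_congr I m r r' fun x hx => h x (by omega),
        run_congr I p r r' _ fun x hx => h x (by omega)]
  | .for x p, r, r', m, h => by
      simp only [bound] at h
      rw [run, run]
      congr 1
      funext i m
      refine run_congr I p _ _ m fun y hy => ?_
      by_cases hyx : y = x
      · simp [hyx]
      · simp [hyx, h y (by omega)]

/-- Restoring all registers below `d` makes programs depend on each other only through the memory,
so the same `d` serves both halves of a sequence. -/
theorem exec_compile (I : CCInstance) : ∀ (p : LoopProg) (d : ℕ) (s : RamState), p.bound ≤ d →
    ∃ s' k, RamExec I (p.compile d) s s' k ∧ k ≤ p.cost.eval I.n ∧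
      s'.mem = p.run I s.reg s.mem ∧ ∀ x < d, s'.reg x = s.reg x
  | store a i j e, d, s, h => by
      simp only [bound] at h
      obtain ⟨s₁, k₁, h₁, hk₁, hm₁, hr₁, hv₁⟩ := i.exec_compile I d s (by omega)
      obtain ⟨s₂, k₂, h₂, hk₂, hm₂, hr₂, hv₂⟩ := j.exec_compile I (d + 1) s₁ (by omega)
      obtain ⟨s₃, k₃, h₃, hk₃, hm₃, hr₃, hv₃⟩ := e.exec_compile I (d + 2) s₂ (by omega)
      have e₂ : s₃.reg (d + 1) = j.eval I s.mem s.reg := by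
        rw [hr₃ _ (by omega), hv₂, hm₁,
          j.eval_congr I s.mem s₁.reg s.reg fun x hx => hr₁ x (by omega)]
      have e₃ : s₃.reg (d + 2) = e.eval I s.mem s.reg := by
        rw [hv₃, hm₂, hm₁, e.eval_congr I s.mem s₂.reg s.reg fun x hx => by
          rw [hr₂ x (by omega), hr₁ x (by omega)]]
      have e₁ : s₃.reg d = i.eval I s.mem s.reg := by
        rw [hr₃ _ (by omega), hr₂ _ (by omega), hv₁]
      refine ⟨_, _, .seq h₁ (.seq h₂ (.seq h₃ (.store _ _ _ _ _))), ?_, ?_, fun x hx => ?_⟩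
      · simp only [cost, RamExpr.cost, Polynomial.eval_add, Polynomial.eval_ofNat]
        omega
      · simp only [RamExpr.eval, e₁, e₂, e₃, run, RamState.setMem, hm₃, hm₂, hm₁]
        rfl
      · simp only [RamState.setMem]
        rw [hr₃ x (by omega), hr₂ x (by omega), hr₁ x hx]
  | seq p q, d, s, h => by
      simp only [bound] at h
      obtain ⟨s₁, k₁, h₁, hk₁, hm₁, hr₁⟩ := exec_compile I p d s (by omega)
      obtain ⟨s₂, k₂, h₂, hk₂, hm₂, hr₂⟩ := exec_compile I q d s₁ (by omega)
      refine ⟨_, _, .seq h₁ h₂, ?_, ?_, fun x hx => by rw [hr₂ x hx, hr₁ x hx]⟩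
      · simp only [cost, Polynomial.eval_add]
        omega
      · rw [hm₂, hm₁, run, run_congr I q s₁.reg s.reg _ fun x hx => hr₁ x (by omega)]
  | ite e p, d, s, h => by
      simp only [bound] at h
      obtain ⟨s₁, k₁, h₁, hk₁, hm₁, hr₁, hv₁⟩ := e.exec_compile I d s (by omega)
      by_cases hc : e.eval I s.mem s.reg = 0
      · refine ⟨_, _, .seq h₁ (.iteFalse (by simpa [RamExpr.eval, hv₁]) (.skip _)), ?_, ?_, hr₁⟩
        · simp only [cost, RamExpr.cost, Polynomial.eval_add, Polynomial.eval_ofNat]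
          omega
        · simp [run, hc, hm₁]
      · obtain ⟨s₂, k₂, h₂, hk₂, hm₂, hr₂⟩ := exec_compile I p d s₁ (by omega)
        refine ⟨_, _, .seq h₁ (.iteTrue (by simpa [RamExpr.eval, hv₁]) h₂), ?_, ?_,
          fun x hx => by rw [hr₂ x hx, hr₁ x hx]⟩
        · simp only [cost, RamExpr.cost, Polynomial.eval_add, Polynomial.eval_ofNat]
          omega
        · rw [hm₂, hm₁, run, if_pos hc,
            run_congr I p s₁.reg s.reg _ fun x hx => hr₁ x (by omega)]
  | .for x p, d, s, h => by
      simp only [bound] at h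
      let Q : ℕ → RamState → Prop := fun i s' =>
        s'.mem = forLoop i (fun i => p.run I (Function.update s.reg x i)) s.mem ∧ s'.reg x = i ∧
        (∀ y < d, y ≠ x → s'.reg y = s.reg y) ∧ s'.reg d = s.reg x
      have h1 : d ≠ x := by omega
      obtain ⟨s₁, k₁, h₁, hk₁, hm₁, hx₁, hr₁, hs₁⟩ := RamExec.while_lt I x
        (p.cost.eval I.n + 4)
        (.seq (p.compile (d + 1)) (.assign x (.add (.reg x) (.const 1)))) Q (fun _ _ hq => hq.2.1)
        (fun i hi s' hq => by
          obtain ⟨hm, hx, hr, hs⟩ := hq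
          obtain ⟨s₂, k₂, h₂, hk₂, hm₂, hr₂⟩ := exec_compile I p (d + 1) s' (by omega)
          refine ⟨_, _, .seq h₂ (.assign _ _ _), ?_, ?_, ?_, ?_, ?_⟩
          · simp only [RamExpr.cost]
            omega
          · rw [RamState.mem_setReg, hm₂, hm, forLoop_succ]
            refine run_congr I p _ _ _ fun y hy => ?_
            by_cases hyx : y = x
            · simp [hyx, hx]
            · simp [hyx, hr y (by omega) hyx]
          · simp [RamState.reg_setReg, RamExpr.eval, hr₂ x (by omega), hx]
          · intro y hy hyx
            rw [RamState.reg_setReg, if_neg hyx, hr₂ y (by omega), hr y hy hyx]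
          · simp [RamState.reg_setReg, h1, hr₂ d (by omega), hs])
        ((s.setReg d (s.reg x)).setReg x 0) (by
          refine ⟨rfl, ?_, fun y hy hyx => ?_, ?_⟩
          · simp [RamState.reg_setReg]
          · simp [RamState.reg_setReg, hyx, hy.ne]
          · simp [RamState.reg_setReg, h1])
      refine ⟨_, _, .seq (.assign _ _ _) (.seq (.assign _ _ _) (.seq h₁ (.assign _ _ _))),
        ?_, ?_, fun y hy => ?_⟩
      · simp only [cost, RamExpr.cost, Polynomial.eval_add, Polynomial.eval_mul, Polynomial.eval_X,
          Polynomial.eval_ofNat]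
        rw [show p.cost.eval I.n + 4 + 4 = p.cost.eval I.n + 8 from rfl] at hk₁
        omega
      · rw [RamState.mem_setReg, hm₁, run]
      · by_cases hyx : y = x
        · simp [RamState.reg_setReg, hyx, RamExpr.eval, hs₁]
        · simp [RamState.reg_setReg, hyx, hr₁ y hy hyx]

end LoopProg

/-! ### Loops that fill a column or a table -/

namespace LoopProg

/-- Updating in place agrees with updating simultaneously as long as the new entry `i` does not
depend on the entries before `i`. It may depend on the old entry `i` itself, as the relabelling by a
pivot does. -/
theorem forLoop_set_column (n a : ℕ) (g : ℕ → Memory → ℕ) (m : Memory)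
    (hg : ∀ i < n, ∀ m' : Memory, (∀ b x y, ¬ (b = a ∧ x < i ∧ y = 0) → m' b x y = m b x y) →
      g i m' = g i m) :
    forLoop n (fun i m' => Memory.set m' a i 0 (g i m')) m =
      fun b x y => if b = a ∧ x < n ∧ y = 0 then g x m else m b x y := by
  refine forLoop_induction
    (Q := fun i m' => m' = fun b x y => if b = a ∧ x < i ∧ y = 0 then g x m else m b x y) ?_ ?_
  · funext b x y
    simp
  · rintro i hi m' rfl
    rw [hg i hi _ fun b x y h => if_neg h]
    funext b x y
    simp only [Memory.set]
    by_cases h : b = a ∧ x = i ∧ y = 0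
    · obtain ⟨rfl, rfl, rfl⟩ := h
      simp
    · rw [if_neg h]
      congr 1
      refine propext ⟨fun h' => ⟨h'.1, by omega, h'.2.2⟩, fun h' => ⟨h'.1, ?_, h'.2.2⟩⟩
      have : x ≠ i := fun e => h ⟨h'.1, e, h'.2.2⟩
      omega

/-- Here the new entries must not depend on the array being written. -/
theorem forLoop_set_table (n a : ℕ) (g : ℕ → ℕ → Memory → ℕ) (m : Memory)
    (hg : ∀ i < n, ∀ j < n, ∀ m' : Memory, (∀ b, b ≠ a → m' b = m b) → g i j m' = g i j m) :
    forLoop n (fun i => forLoop n (fun j m' => Memory.set m' a i j (g i j m'))) m =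
      fun b x y => if b = a ∧ x < n ∧ y < n then g x y m else m b x y := by
  refine forLoop_induction
    (Q := fun i m' => m' = fun b x y => if b = a ∧ x < i ∧ y < n then g x y m else m b x y) ?_ ?_
  · funext b x y
    simp
  · rintro i hi m' rfl
    refine forLoop_induction
      (Q := fun j m' => m' = fun b x y => if b = a ∧ (x < i ∧ y < n ∨ x = i ∧ y < j) then g x y m
        else m b x y) ?_ ?_ |>.trans ?_
    · funext b x y
      simp
    · rintro j hj m' rfl
      rw [hg i hi j hj _ fun b hb => by funext x y; simp [hb]]
      funext b x y
      simp only [Memory.set]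
      by_cases h : b = a ∧ x = i ∧ y = j
      · obtain ⟨rfl, rfl, rfl⟩ := h
        simp
      · rw [if_neg h]
        congr 1
        refine propext ⟨fun h' => ⟨h'.1, by omega⟩, fun h' => ⟨h'.1, ?_⟩⟩
        have : ¬ (x = i ∧ y = j) := fun e => h ⟨h'.1, e⟩
        omega
    · funext b x y
      congr 1
      refine propext (and_congr_right fun _ => ?_)
      omega

end LoopProg

/-! ### Correlation clustering of a graph given by its adjacency matrix

The graph on `{0, …, n - 1}` is given by a symmetric matrix `H` of zeros and ones, with ones on the
diagonal; pairs are ordered. -/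

section Pivot

/-- Two of the three pairs of a triangle are positive. -/
def IsBadTriangle (H : ℕ → ℕ → ℕ) (i j k : ℕ) : Prop := H i j + H j k + H k i = 2

instance (H : ℕ → ℕ → ℕ) (i j k : ℕ) : Decidable (IsBadTriangle H i j k) :=
  inferInstanceAs (Decidable (_ = _))

/-- Whether a pair is treated wrongly by a labelling. -/
def mistake (H : ℕ → ℕ → ℕ) (l : ℕ → ℕ) (i j : ℕ) : ℕ :=
  if H i j = (if l i = l j then 1 else 0) then 0 else 1

structure IsGraphMatrix (n : ℕ) (H : ℕ → ℕ → ℕ) : Prop where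
  le_one : ∀ i < n, ∀ j < n, H i j ≤ 1
  diag : ∀ i < n, H i i = 1
  symm : ∀ i < n, ∀ j < n, H i j = H j i

variable {n : ℕ} {H : ℕ → ℕ → ℕ}

theorem IsBadTriangle.rotate {i j k : ℕ} (h : IsBadTriangle H i j k) : IsBadTriangle H j k i := by
  unfold IsBadTriangle at *
  omega

/-- Parity: with `i = j` the three entries add up to `1 + 2 * H i k`, which is not 2. -/
theorem IsBadTriangle.ne (hH : IsGraphMatrix n H) {i j k : ℕ} (hi : i < n) (hk : k < n)
    (h : IsBadTriangle H i j k) : i ≠ j := by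
  rintro rfl
  have h1 := hH.diag i hi
  have h2 := hH.symm i hi k hk
  unfold IsBadTriangle at h
  omega

/-- Having the same label is transitive, so a labelling cannot agree with a triangle in which
exactly two pairs are positive. -/
theorem IsBadTriangle.one_le_mistake (l : ℕ → ℕ) {i j k : ℕ} (h : IsBadTriangle H i j k) :
    1 ≤ mistake H l i j + mistake H l j k + mistake H l k i := by
  unfold IsBadTriangle at h
  unfold mistake
  split_ifs <;> omega

theorem sum_sum_single {i j : ℕ} (hi : i < n) (hj : j < n) (f : ℕ → ℕ → ℕ) :
    ∑ x ∈ Finset.range n, ∑ y ∈ Finset.range n, (if x = i ∧ y = j then f x y else 0) = f i j := by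
  rw [Finset.sum_eq_single_of_mem i (by simpa) fun x _ hx => by simp [hx],
    Finset.sum_eq_single_of_mem j (by simpa) fun y _ hy => by simp [hy]]
  simp

/-- Sum over the ordered pairs of vertices. -/
def pairSum (n : ℕ) (f : ℕ → ℕ → ℕ) : ℕ := ∑ x ∈ Finset.range n, ∑ y ∈ Finset.range n, f x y

theorem pairSum_congr {f g : ℕ → ℕ → ℕ} (h : ∀ i < n, ∀ j < n, f i j = g i j) :
    pairSum n f = pairSum n g :=
  Finset.sum_congr rfl fun i hi => Finset.sum_congr rfl fun j hj =>
    h i (Finset.mem_range.1 hi) j (Finset.mem_range.1 hj)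

theorem pairSum_le {f g : ℕ → ℕ → ℕ} (h : ∀ i < n, ∀ j < n, f i j ≤ g i j) :
    pairSum n f ≤ pairSum n g :=
  Finset.sum_le_sum fun i hi => Finset.sum_le_sum fun j hj =>
    h i (Finset.mem_range.1 hi) j (Finset.mem_range.1 hj)

theorem pairSum_add (f g : ℕ → ℕ → ℕ) :
    pairSum n (fun i j => f i j + g i j) = pairSum n f + pairSum n g := by
  simp only [pairSum, Finset.sum_add_distrib]

/-! ### Greedy packing of bad triangles -/

open LoopExpr LoopProg

/-- Is the triangle on three variables bad? -/
def badExpr (i j k : ℕ) : LoopExpr :=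
  .bin .eq (.bin .add (.bin .add (.bin (.load 2) (.var i) (.var j))
    (.bin (.load 2) (.var j) (.var k))) (.bin (.load 2) (.var k) (.var i))) (.const 2)

/-- A greedy maximal packing of bad triangles of array `2`, whose pairs are marked in array `3`. -/
def packProg : LoopProg :=
  .seq (.for 0 (.for 1 (.store 3 (.var 0) (.var 1) (.const 0))))
    (.for 0 (.for 1 (.for 2 (.ite
      (.ite (.bin .add (.bin .add (.bin (.load 3) (.var 0) (.var 1))
        (.bin (.load 3) (.var 1) (.var 2))) (.bin (.load 3) (.var 2) (.var 0)))
        (.const 0) (badExpr 0 1 2))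
      (.seq (.store 3 (.var 0) (.var 1) (.const 1)) (.seq (.store 3 (.var 1) (.var 2) (.const 1))
        (.store 3 (.var 2) (.var 0) (.const 1))))))))

theorem eval_badExpr (I : CCInstance) (m : Memory) (r : ℕ → ℕ) (i j k : ℕ) :
    (badExpr i j k).eval I m r = if IsBadTriangle (m 2) (r i) (r j) (r k) then 1 else 0 := rfl

/-- The pairs marked in array `3` come from a packing of bad triangles of array `2`. -/
structure IsPacking (n : ℕ) (m₀ m : Memory) : Prop where
  frame : ∀ b, b ≠ 3 → m b = m₀ b
  le_one : ∀ i < n, ∀ j < n, m 3 i j ≤ 1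
  sum_le : ∀ l : ℕ → ℕ, pairSum n (m 3) ≤ 3 * pairSum n fun i j => m 3 i j * mistake (m₀ 2) l i j

-- Triangles are oriented: only the ordered pairs `(i, j)`, `(j, k)`, `(k, i)` have to be unmarked
-- and become marked, so the packing is disjoint in ordered pairs.
open Classical in
noncomputable def packStep (i j k : ℕ) (m : Memory) : Memory :=
  if m 3 i j + m 3 j k + m 3 k i = 0 ∧ IsBadTriangle (m 2) i j k then
    ((m.set 3 i j 1).set 3 j k 1).set 3 k i 1
  else m

/-- An added triangle raises the number of marks by 3 and the mistakes of any labelling on marked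
pairs by at least 1, which preserves `sum_le`. If a bad triangle is rejected, one of its pairs was
already marked. -/
theorem packStep_spec {m₀ m : Memory} (hH : IsGraphMatrix n (m₀ 2)) (hm : IsPacking n m₀ m)
    {i j k : ℕ} (hi : i < n) (hj : j < n) (hk : k < n) :
    IsPacking n m₀ (packStep i j k m) ∧ (∀ x y, m 3 x y ≤ packStep i j k m 3 x y) ∧
      (IsBadTriangle (m₀ 2) i j k →
        1 ≤ packStep i j k m 3 i j + packStep i j k m 3 j k + packStep i j k m 3 k i) := by
  have h2 : m 2 = m₀ 2 := hm.frame 2 (by norm_num)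
  unfold packStep
  by_cases h : m 3 i j + m 3 j k + m 3 k i = 0 ∧ IsBadTriangle (m 2) i j k
  swap
  · rw [if_neg h]
    refine ⟨hm, fun _ _ => le_rfl, fun hb => ?_⟩
    rw [← h2] at hb
    by_contra hc
    exact h ⟨by omega, hb⟩
  rw [if_pos h]
  obtain ⟨h0, hb⟩ := h
  rw [h2] at hb
  have hij := hb.ne hH hi hk
  have hjk := hb.rotate.ne hH hj hi
  have hki := hb.rotate.rotate.ne hH hk hj
  -- The vertices are distinct and the three pairs were unmarked, so the overwriting is the addition
  -- of three disjoint indicators.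
  have hc : ∀ x y, (((m.set 3 i j 1).set 3 j k 1).set 3 k i 1) 3 x y =
      m 3 x y + (if x = i ∧ y = j then 1 else 0) + (if x = j ∧ y = k then 1 else 0) +
        (if x = k ∧ y = i then 1 else 0) := by
    intro x y
    simp only [Memory.set, true_and]
    by_cases h1 : x = i ∧ y = j
    · obtain ⟨rfl, rfl⟩ := h1
      have : ¬ (x = k ∧ y = x) := fun h => hki h.1.symm
      have h' : ¬ (x = y ∧ y = k) := fun h => hij h.1
      simp only [this, h', if_false, and_self, if_true]
      omega
    · by_cases h2 : x = j ∧ y = k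
      · obtain ⟨rfl, rfl⟩ := h2
        have : ¬ (x = y ∧ y = i) := fun h => hjk h.1
        simp only [this, h1, if_false, and_self, if_true]
        omega
      · by_cases h3 : x = k ∧ y = i
        · obtain ⟨rfl, rfl⟩ := h3
          simp only [h1, h2, if_false, and_self, if_true]
          omega
        · simp [h1, h2, h3]
  refine ⟨⟨fun b hb => ?_, fun x hx y hy => ?_, fun l => ?_⟩, fun x y => by rw [hc]; omega,
    fun _ => ?_⟩
  · rw [← hm.frame b hb]
    funext x y
    simp [Memory.set, hb]
  · have := hm.le_one x hx y hy
    simp only [Memory.set, true_and]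
    split_ifs <;> omega
  · have e1 : pairSum n (((m.set 3 i j 1).set 3 j k 1).set 3 k i 1 3) = pairSum n (m 3) + 3 := by
      rw [pairSum_congr fun x _ y _ => hc x y, pairSum_add, pairSum_add, pairSum_add]
      simp only [pairSum]
      rw [sum_sum_single hi hj fun _ _ => 1, sum_sum_single hj hk fun _ _ => 1,
        sum_sum_single hk hi fun _ _ => 1]
    have e2 : pairSum n (fun x y => ((m.set 3 i j 1).set 3 j k 1).set 3 k i 1 3 x y *
        mistake (m₀ 2) l x y) = pairSum n (fun x y => m 3 x y * mistake (m₀ 2) l x y) +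
        mistake (m₀ 2) l i j + mistake (m₀ 2) l j k + mistake (m₀ 2) l k i := by
      rw [pairSum_congr fun x _ y _ => by rw [hc x y, add_mul, add_mul, add_mul],
        pairSum_add, pairSum_add, pairSum_add]
      simp only [pairSum, ite_mul, one_mul, zero_mul]
      rw [sum_sum_single hi hj fun x y => mistake (m₀ 2) l x y,
        sum_sum_single hj hk fun x y => mistake (m₀ 2) l x y,
        sum_sum_single hk hi fun x y => mistake (m₀ 2) l x y]
    rw [e1, e2]
    have := hm.sum_le l
    have := hb.one_le_mistake l
    omega
  · rw [hc i j]
    simp only [and_self, if_true]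
    omega

/-- Marks are never removed, so a bad triangle that has a marked pair after its visit keeps one: the
packing is maximal. -/
theorem run_packProg (I : CCInstance) (r : ℕ → ℕ) (m₀ : Memory) (hH : IsGraphMatrix I.n (m₀ 2)) :
    IsPacking I.n m₀ (packProg.run I r m₀) ∧
      ∀ i < I.n, ∀ j < I.n, ∀ k < I.n, IsBadTriangle (m₀ 2) i j k →
        1 ≤ packProg.run I r m₀ 3 i j + packProg.run I r m₀ 3 j k + packProg.run I r m₀ 3 k i := by
  have hrun : packProg.run I r m₀ = forLoop I.n (fun i => forLoop I.n fun j => forLoop I.n fun k =>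
      packStep i j k) (forLoop I.n (fun i => forLoop I.n fun j m => Memory.set m 3 i j 0) m₀) := by
    unfold packProg
    simp only [LoopProg.run, LoopExpr.eval, Function.update_self, ne_eq, not_false_eq_true,
      Function.update_of_ne, zero_ne_one, OfNat.one_ne_ofNat, OfNat.zero_ne_ofNat]
    congr 1
    funext i m
    congr 1
    funext j m
    congr 1
    funext k m
    unfold packStep
    rw [eval_badExpr]
    simp [BinOp.eval, BinOp.toRam, RamExpr.eval]
    split_ifs <;> first | rfl | (exfalso; tauto)
  rw [hrun, LoopProg.forLoop_set_table _ _ (fun _ _ _ => 0) _ fun _ _ _ _ _ _ => rfl]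
  set m₁ : Memory := fun b x y => if b = 3 ∧ x < I.n ∧ y < I.n then 0 else m₀ b x y with hm₁
  have hp : IsPacking I.n m₀ m₁ := by
    refine ⟨fun b hb => ?_, fun i hi j hj => ?_, fun l => ?_⟩
    · funext x y
      simp [hm₁, hb]
    · simp [hm₁, hi, hj]
    · rw [pairSum_congr (g := fun _ _ => 0) fun i hi j hj => by simp [hm₁, hi, hj]]
      simp [pairSum]
  -- In `P q`, the predicate `q` selects the triples visited so far, in lexicographic order of the
  -- three nested loops.
  let P : (ℕ → ℕ → ℕ → Prop) → Memory → Prop := fun q m => IsPacking I.n m₀ m ∧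
    ∀ i < I.n, ∀ j < I.n, ∀ k < I.n, q i j k → IsBadTriangle (m₀ 2) i j k →
      1 ≤ m 3 i j + m 3 j k + m 3 k i
  have hP : ∀ (q q' : ℕ → ℕ → ℕ → Prop), (∀ i < I.n, ∀ j < I.n, ∀ k < I.n, q' i j k → q i j k) →
      ∀ m, P q m → P q' m :=
    fun q q' h m hm => ⟨hm.1, fun i hi j hj k hk hq => hm.2 i hi j hj k hk (h i hi j hj k hk hq)⟩
  have main := forLoop_induction (n := I.n) (f := fun i => forLoop I.n fun j => forLoop I.n fun k =>
      packStep i j k) (m := m₁) (fun a => P fun i _ _ => i < a)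
    ⟨hp, fun _ _ _ _ _ _ h => absurd h (by omega)⟩ fun i hi m hm => by
      refine hP (fun i' j _ => i' < i ∨ i' = i ∧ j < I.n) _
        (fun i' _ j hj _ _ h => by omega) _ ?_
      refine forLoop_induction (fun a => P fun i' j _ => i' < i ∨ i' = i ∧ j < a)
        (hP _ _ (fun _ _ _ _ _ _ h => by omega) _ hm) fun j hj m hm => ?_
      refine hP (fun i' j' k => i' < i ∨ i' = i ∧ (j' < j ∨ j' = j ∧ k < I.n)) _
        (fun i' _ j' _ k hk h => by omega) _ ?_
      refine forLoop_induction
        (fun a => P fun i' j' k => i' < i ∨ i' = i ∧ (j' < j ∨ j' = j ∧ k < a))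
        (hP _ _ (fun _ _ _ _ _ _ h => by omega) _ hm) fun k hk m hm => ?_
      obtain ⟨h1, h2, h3⟩ := packStep_spec hH hm.1 hi hj hk
      refine ⟨h1, fun i' hi' j' hj' k' hk' hq hb => ?_⟩
      by_cases he : i' = i ∧ j' = j ∧ k' = k
      · obtain ⟨rfl, rfl, rfl⟩ := he
        exact h3 hb
      · have := hm.2 i' hi' j' hj' k' hk' (by omega) hb
        have := h2 i' j'
        have := h2 j' k'
        have := h2 k' i'
        omega
  exact ⟨main.1, fun i hi j hj k hk => main.2 i hi j hj k hk hi⟩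

/-- A sum over the pairs of active vertices that form a bad triangle with the variable `1`. -/
def sumBadExpr (e : LoopExpr) : LoopExpr :=
  .sum 3 (.sum 4 (.ite (.bin .add (.bin (.load 4) (.var 3) (.const 0))
    (.bin (.load 4) (.var 4) (.const 0))) (.const 0) (.ite (badExpr 3 4 1) e (.const 0))))

/-- Pivoting on the graph of array `2`, with budgets from array `3`.  Array `4` holds the labels,
which are zero for the active vertices. -/
def pivotProg : LoopProg :=
  .seq (.for 0 (.store 4 (.var 0) (.const 0) (.const 0)))
    (.for 0 (.for 1 (.ite (.ite (.bin (.load 4) (.var 1) (.const 0)) (.const 0)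
      (.bin .lt (sumBadExpr (.const 1)) (.bin .add (.bin .add (.const 1)
        (sumBadExpr (.bin (.load 3) (.var 3) (.var 4)))) (.bin .add
        (sumBadExpr (.bin (.load 3) (.var 3) (.var 4)))
        (sumBadExpr (.bin (.load 3) (.var 3) (.var 4)))))))
      (.for 2 (.store 4 (.var 2) (.const 0)
        (.ite (.ite (.bin (.load 4) (.var 2) (.const 0)) (.const 0)
          (.bin (.load 2) (.var 1) (.var 2)))
          (.bin .add (.var 1) (.const 1)) (.bin (.load 4) (.var 2) (.const 0))))))))

/-- Both vertices are active and form a bad triangle with `k`. -/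
def activeBad (m : Memory) (k i j : ℕ) : ℕ :=
  if m 4 i 0 + m 4 j 0 = 0 ∧ IsBadTriangle (m 2) i j k then 1 else 0

theorem activeBad_eq (m : Memory) (k i j : ℕ) : activeBad m k i j =
    if m 4 i 0 + m 4 j 0 = 0 ∧ m 2 i j + m 2 j k + m 2 k i = 2 then 1 else 0 := rfl

/-- The pivot `k` makes few mistakes, compared to the budget. -/
def IsGoodPivot (n : ℕ) (m : Memory) (k : ℕ) : Prop :=
  m 4 k 0 = 0 ∧
    pairSum n (activeBad m k) ≤ 3 * pairSum n fun i j => activeBad m k i j * m 3 i j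

/-- The memory after pivoting on `k`. -/
def pivotOn (n k : ℕ) (m : Memory) : Memory := fun b x y =>
  if b = 4 ∧ x < n ∧ y = 0 then (if m 4 x 0 = 0 ∧ m 2 k x ≠ 0 then k + 1 else m 4 x 0)
  else m b x y

open Classical in
noncomputable def pivotStep (n k : ℕ) (m : Memory) : Memory :=
  if IsGoodPivot n m k then pivotOn n k m else m

/-- Not both vertices are active. -/
def settled (m : Memory) (i j : ℕ) : ℕ := if m 4 i 0 + m 4 j 0 = 0 then 0 else 1

/-- Invariant of the pivot algorithm. By `label`, a label `k + 1` is in use only once `k` is no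
longer active, so a new pivot brings a fresh label. By `twin`, vertices with equal columns are never
separated. In `sum_le`, the mistakes on settled pairs are paid for by the marks on settled pairs. -/
structure IsPivoting (n : ℕ) (m₀ m : Memory) : Prop where
  frame : ∀ b, b ≠ 4 → m b = m₀ b
  label : ∀ v < n, m 4 v 0 ≠ 0 → ∃ k < n, m 4 v 0 = k + 1 ∧ m 4 k 0 ≠ 0
  twin : ∀ u < n, ∀ v < n, (∀ k < n, m₀ 2 k u = m₀ 2 k v) → m 4 u 0 = m 4 v 0
  sum_le : pairSum n (fun i j => settled m i j * mistake (m₀ 2) (fun v => m 4 v 0) i j) ≤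
    3 * pairSum n fun i j => settled m i j * m₀ 3 i j

/-- Pivoting on `k` errs on a newly settled pair exactly when the pair forms a bad triangle with
`k`. All these pairs become settled, so their marks enter the budget, and goodness of the pivot pays
for the new mistakes. -/
theorem IsPivoting.pivotOn {m₀ m : Memory} (hH : IsGraphMatrix n (m₀ 2)) (hm : IsPivoting n m₀ m)
    {k : ℕ} (hk : k < n) (hg : IsGoodPivot n m k) : IsPivoting n m₀ (pivotOn n k m) := by
  have h2 : m 2 = m₀ 2 := hm.frame 2 (by norm_num)
  have h3 : m 3 = m₀ 3 := hm.frame 3 (by norm_num)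
  have hv : ∀ v < n, _root_.pivotOn n k m 4 v 0 =
      if m 4 v 0 = 0 ∧ m₀ 2 k v ≠ 0 then k + 1 else m 4 v 0 := by
    intro v hv
    simp [_root_.pivotOn, hv, h2]
  have hkk := hH.diag k hk
  have hk' : _root_.pivotOn n k m 4 k 0 ≠ 0 := by
    rw [hv k hk, if_pos ⟨hg.1, by omega⟩]
    omega
  refine ⟨fun b hb => ?_, fun v hvn h0 => ?_, fun u hu v hvn ht => ?_, ?_⟩
  · rw [← hm.frame b hb]
    funext x y
    simp [_root_.pivotOn, hb]
  · by_cases hc : m 4 v 0 = 0 ∧ m₀ 2 k v ≠ 0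
    · exact ⟨k, hk, by rw [hv v hvn, if_pos hc], hk'⟩
    · rw [hv v hvn, if_neg hc] at h0 ⊢
      obtain ⟨k', hkn, h1, h4⟩ := hm.label v hvn h0
      refine ⟨k', hkn, h1, ?_⟩
      rw [hv k' hkn]
      split_ifs <;> omega
  · rw [hv u hu, hv v hvn, hm.twin u hu v hvn ht, ht k hk]
  · have key1 : ∀ i < n, ∀ j < n, settled (_root_.pivotOn n k m) i j *
        mistake (m₀ 2) (fun v => _root_.pivotOn n k m 4 v 0) i j =
        settled m i j * mistake (m₀ 2) (fun v => m 4 v 0) i j + activeBad m k i j := by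
      intro i hi j hj
      have hvi := hv i hi
      have hvj := hv j hj
      have a1 := hH.le_one i hi j hj
      have a2 := hH.le_one k hk i hi
      have a3 := hH.le_one k hk j hj
      have a4 := hH.symm k hk j hj
      rw [← h2] at a1 a2 a3 a4 hvi hvj ⊢
      -- The label `k + 1` is fresh, because a good pivot is still active. Pairs with a vertex
      -- settled earlier therefore keep their status.
      have hli : m 4 i 0 ≠ k + 1 := fun h => by
        obtain ⟨k', _, h5, h6⟩ := hm.label i hi (by omega)
        obtain rfl : k' = k := by omega
        exact h6 hg.1
      have hlj : m 4 j 0 ≠ k + 1 := fun h => by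
        obtain ⟨k', _, h5, h6⟩ := hm.label j hj (by omega)
        obtain rfl : k' = k := by omega
        exact h6 hg.1
      have hlj' := hlj.symm
      rw [activeBad_eq]
      unfold settled mistake
      beta_reduce
      generalize _root_.pivotOn n k m 4 i 0 = x' at *
      generalize _root_.pivotOn n k m 4 j 0 = y' at *
      generalize m 4 i 0 = x at *
      generalize m 4 j 0 = y at *
      generalize m 2 i j = p at *
      generalize m 2 k i = q at *
      generalize m 2 k j = s at *
      generalize m 2 j k = s' at *
      subst a4 hvi hvj
      have hp : p = 0 ∨ p = 1 := by omega
      have hq : q = 0 ∨ q = 1 := by omega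
      have hs : s = 0 ∨ s = 1 := by omega
      by_cases hx : x = 0 <;> by_cases hy : y = 0 <;> by_cases hxy : x = y <;>
        rcases hp with rfl | rfl <;> rcases hq with rfl | rfl <;> rcases hs with rfl | rfl <;>
        simp_all
    have key2 : ∀ i < n, ∀ j < n, settled m i j * m₀ 3 i j + activeBad m k i j * m 3 i j ≤
        settled (_root_.pivotOn n k m) i j * m₀ 3 i j := by
      intro i hi j hj
      have hvi := hv i hi
      have hvj := hv j hj
      have a1 := hH.le_one i hi j hj
      have a2 := hH.symm k hk j hj
      rw [h3, ← add_mul]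
      refine Nat.mul_le_mul_right _ ?_
      rw [← h2] at a1 a2 hvi hvj
      rw [activeBad_eq]
      unfold settled
      by_cases hb : m 4 i 0 + m 4 j 0 = 0 ∧ m 2 i j + m 2 j k + m 2 k i = 2
      · have : _root_.pivotOn n k m 4 i 0 + _root_.pivotOn n k m 4 j 0 ≠ 0 := by
          by_cases hki : m 2 k i = 0
          · rw [hvj, if_pos ⟨by omega, by omega⟩]
            omega
          · rw [hvi, if_pos ⟨by omega, hki⟩]
            omega
        rw [if_pos hb.1, if_pos hb, if_neg this]
      · rw [if_neg hb]
        have : _root_.pivotOn n k m 4 i 0 + _root_.pivotOn n k m 4 j 0 = 0 →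
            m 4 i 0 + m 4 j 0 = 0 := by
          rw [hvi, hvj]
          intro h
          split_ifs at h <;> omega
        split_ifs <;> omega
    calc _ = _ := pairSum_congr key1
      _ = _ := pairSum_add _ _
      _ ≤ _ := Nat.add_le_add hm.sum_le hg.2
      _ = 3 * pairSum n (fun i j => settled m i j * m₀ 3 i j + activeBad m k i j * m 3 i j) := by
        rw [pairSum_add, mul_add]
      _ ≤ _ := Nat.mul_le_mul_left _ (pairSum_le key2)

/-- Number of active vertices. -/
def activeCount (n : ℕ) (m : Memory) : ℕ := ((Finset.range n).filter fun v => m 4 v 0 = 0).card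

theorem activeCount_pivotOn_lt {m : Memory} (hH : IsGraphMatrix n (m 2)) {k : ℕ} (hk : k < n)
    (h0 : m 4 k 0 = 0) : activeCount n (pivotOn n k m) < activeCount n m := by
  refine Finset.card_lt_card (Finset.ssubset_iff_of_subset (fun v hv => ?_) |>.2 ⟨k, ?_, ?_⟩)
  · simp only [Finset.mem_filter, Finset.mem_range, pivotOn] at hv ⊢
    refine ⟨hv.1, ?_⟩
    have := hv.2
    simp only [hv.1, and_self, if_true] at this
    split_ifs at this
    exact this
  · simp [hk, h0]
  · have := hH.diag k hk
    simp [pivotOn, hk, h0, this]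

/-- By averaging, there is a good pivot as long as there are active vertices. -/
theorem exists_isGoodPivot {m : Memory}
    (hc : ∀ i < n, ∀ j < n, ∀ k < n, IsBadTriangle (m 2) i j k → 1 ≤ m 3 i j + m 3 j k + m 3 k i)
    (h0 : activeCount n m ≠ 0) : ∃ k < n, IsGoodPivot n m k := by
  by_contra! hno
  set A := (Finset.range n).filter fun v => m 4 v 0 = 0 with hA
  have hAn : A.Nonempty := Finset.card_ne_zero.1 h0
  have hsum : ∀ k, ∀ w : ℕ → ℕ → ℕ, pairSum n (fun i j => activeBad m k i j * w i j) =
      ∑ i ∈ A, ∑ j ∈ A, if IsBadTriangle (m 2) i j k then w i j else 0 := by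
    intro k w
    simp only [pairSum, hA, Finset.sum_filter]
    refine Finset.sum_congr rfl fun i _ => ?_
    split_ifs with hi
    · refine Finset.sum_congr rfl fun j _ => ?_
      by_cases hj : m 4 j 0 = 0 <;> simp [activeBad, hi, hj]
    · exact Finset.sum_eq_zero fun j _ => by simp [activeBad, hi]
  have hlt : ∑ k ∈ A, 3 * pairSum n (fun i j => activeBad m k i j * m 3 i j) <
      ∑ k ∈ A, pairSum n (fun i j => activeBad m k i j * 1) := by
    refine Finset.sum_lt_sum_of_nonempty hAn fun k hk => ?_
    simp only [hA, Finset.mem_filter, Finset.mem_range] at hk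
    have := hno k hk.1
    simp only [IsGoodPivot, hk.2, true_and, not_le] at this
    simpa using this
  simp only [hsum, ← Finset.mul_sum] at hlt
  -- Bad triangles are invariant under rotation, so the marks on each of the three sides have the
  -- same total over all active triples. Each bad triple has a marked side, so one side carries a
  -- third of the number of bad triples, against `hlt`.
  have rot : ∀ w : ℕ → ℕ → ℕ → ℕ, ∑ k ∈ A, ∑ i ∈ A, ∑ j ∈ A,
      (if IsBadTriangle (m 2) i j k then w i j k else 0) =
      ∑ k ∈ A, ∑ i ∈ A, ∑ j ∈ A, (if IsBadTriangle (m 2) i j k then w j k i else 0) := by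
    intro w
    rw [Finset.sum_congr rfl fun k _ => Finset.sum_comm, Finset.sum_comm]
    refine Finset.sum_congr rfl fun j _ => Finset.sum_congr rfl fun k _ =>
      Finset.sum_congr rfl fun i _ => ?_
    congr 1
    exact propext ⟨fun h => h.rotate.rotate, fun h => h.rotate⟩
  have r1 := rot fun i j _ => m 3 i j
  have r2 := rot fun i j k => m 3 j k
  have hle : ∑ k ∈ A, ∑ i ∈ A, ∑ j ∈ A, (if IsBadTriangle (m 2) i j k then 1 else 0) ≤
      ∑ k ∈ A, ∑ i ∈ A, ∑ j ∈ A,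
        ((if IsBadTriangle (m 2) i j k then m 3 i j else 0) +
        (if IsBadTriangle (m 2) i j k then m 3 j k else 0) +
        (if IsBadTriangle (m 2) i j k then m 3 k i else 0)) := by
    refine Finset.sum_le_sum fun k hk => Finset.sum_le_sum fun i hi => Finset.sum_le_sum
      fun j hj => ?_
    simp only [hA, Finset.mem_filter, Finset.mem_range] at hi hj hk
    split_ifs with h
    · exact hc i hi.1 j hj.1 k hk.1 h
    · omega
  simp only [Finset.sum_add_distrib] at hle
  omega

theorem pivotStep_spec {m₀ m : Memory} (hH : IsGraphMatrix n (m₀ 2)) (hm : IsPivoting n m₀ m)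
    {k : ℕ} (hk : k < n) : IsPivoting n m₀ (pivotStep n k m) ∧
      (pivotStep n k m = m ∧ ¬ IsGoodPivot n m k ∨
        activeCount n (pivotStep n k m) < activeCount n m) := by
  unfold pivotStep
  split_ifs with h
  · refine ⟨hm.pivotOn hH hk h, .inr (activeCount_pivotOn_lt ?_ hk h.1)⟩
    rwa [hm.frame 2 (by norm_num)]
  · exact ⟨hm, .inl ⟨rfl, h⟩⟩

/-- Each round over all vertices finds a pivot, unless all vertices have a label. -/
theorem pivotRound_spec {m₀ m : Memory} (hH : IsGraphMatrix n (m₀ 2))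
    (hc : ∀ i < n, ∀ j < n, ∀ k < n, IsBadTriangle (m₀ 2) i j k →
      1 ≤ m₀ 3 i j + m₀ 3 j k + m₀ 3 k i) (hm : IsPivoting n m₀ m) :
    IsPivoting n m₀ (forLoop n (pivotStep n) m) ∧
      (activeCount n (forLoop n (pivotStep n) m) = 0 ∨
        activeCount n (forLoop n (pivotStep n) m) < activeCount n m) := by
  -- Until a pivot is found the memory is unchanged, so the vertices rejected so far are bad pivots
  -- for the initial memory too.
  have := forLoop_induction (n := n) (f := pivotStep n) (m := m)
    (fun i m' => IsPivoting n m₀ m' ∧ ((m' = m ∧ ∀ k < i, ¬ IsGoodPivot n m k) ∨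
      activeCount n m' < activeCount n m)) ⟨hm, .inl ⟨rfl, fun _ h => absurd h (by omega)⟩⟩
    (fun i hi m' hm' => by
      obtain ⟨h1, h2⟩ := pivotStep_spec hH hm'.1 hi
      refine ⟨h1, ?_⟩
      rcases hm'.2 with ⟨rfl, h3⟩ | h3
      · rcases h2 with ⟨h4, h5⟩ | h4
        · refine .inl ⟨h4, fun k hk => ?_⟩
          rcases Nat.lt_succ_iff_lt_or_eq.1 hk with h | rfl
          · exact h3 k h
          · exact h5
        · exact .inr h4
      · rcases h2 with ⟨h4, _⟩ | h4
        · exact .inr (by rwa [h4])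
        · exact .inr (h4.trans h3))
  refine ⟨this.1, ?_⟩
  rcases this.2 with ⟨h1, h2⟩ | h1
  · left
    rw [h1]
    by_contra h0
    obtain ⟨k, hk, hg⟩ := exists_isGoodPivot (m := m) (by
      rwa [hm.frame 2 (by norm_num), hm.frame 3 (by norm_num)]) h0
    exact h2 k hk hg
  · exact .inr h1

theorem eval_sumBadExpr (I : CCInstance) (m : Memory) (r : ℕ → ℕ) (e : LoopExpr) :
    (sumBadExpr e).eval I m r = pairSum I.n fun i j => activeBad m (r 1) i j *
      e.eval I m (Function.update (Function.update r 3 i) 4 j) := by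
  simp only [sumBadExpr, LoopExpr.eval, pairSum]
  refine Finset.sum_congr rfl fun i _ => Finset.sum_congr rfl fun j _ => ?_
  rw [eval_badExpr]
  simp only [BinOp.eval, BinOp.toRam, RamExpr.eval, activeBad]
  simp only [ne_eq, Nat.reduceEqDiff, not_false_eq_true,
    Function.update_of_ne, Function.update_self, OfNat.one_ne_ofNat]
  split_ifs <;> simp_all

theorem run_pivotProg (I : CCInstance) (r : ℕ → ℕ) (m₀ : Memory) (hH : IsGraphMatrix I.n (m₀ 2))
    (hc : ∀ i < I.n, ∀ j < I.n, ∀ k < I.n, IsBadTriangle (m₀ 2) i j k →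
      1 ≤ m₀ 3 i j + m₀ 3 j k + m₀ 3 k i) :
    IsPivoting I.n m₀ (pivotProg.run I r m₀) ∧ ∀ v < I.n, pivotProg.run I r m₀ 4 v 0 ≠ 0 := by
  have hrun : pivotProg.run I r m₀ = forLoop I.n (fun _ => forLoop I.n (pivotStep I.n))
      (forLoop I.n (fun i m => Memory.set m 4 i 0 0) m₀) := by
    unfold pivotProg
    simp only [LoopProg.run, LoopExpr.eval, Function.update_self]
    congr 1
    funext i m
    congr 1
    funext k m
    have hl : forLoop I.n (fun v m' => Memory.set m' 4 v 0
        (if m' 4 v 0 = 0 ∧ m' 2 k v ≠ 0 then k + 1 else m' 4 v 0)) m = pivotOn I.n k m :=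
      LoopProg.forLoop_set_column I.n 4
        (fun v m => if m 4 v 0 = 0 ∧ m 2 k v ≠ 0 then k + 1 else m 4 v 0) m (fun v hv m' h => by
        rw [h 4 v 0 (by omega), h 2 k v (by omega)])
    unfold pivotStep
    rw [← hl]
    simp only [eval_sumBadExpr, LoopExpr.eval]
    simp [BinOp.eval, BinOp.toRam, RamExpr.eval]
    unfold IsGoodPivot
    -- The program spells out `a ≤ 3 * b` with addition and strict comparison.
    have h1 : ∀ a b : ℕ, a < 1 + b + (b + b) ↔ a ≤ 3 * b := by omega
    simp only [h1]
    split_ifs <;> first | rfl | (exfalso; simp_all)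
  rw [hrun, LoopProg.forLoop_set_column _ _ (fun _ _ => 0) _ fun _ _ _ _ => rfl]
  set m₁ : Memory := fun b x y => if b = 4 ∧ x < I.n ∧ y = 0 then 0 else m₀ b x y with hm₁
  have h1 : ∀ v < I.n, m₁ 4 v 0 = 0 := fun v hv => by simp [hm₁, hv]
  have hp : IsPivoting I.n m₀ m₁ := by
    refine ⟨fun b hb => ?_, fun v hv h => absurd (h1 v hv) h,
      fun u hu v hv _ => by rw [h1 u hu, h1 v hv], ?_⟩
    · funext x y
      simp [hm₁, hb]
    · rw [pairSum_congr (g := fun _ _ => 0) fun i hi j hj => by simp [settled, h1 i hi, h1 j hj]]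
      simp [pairSum]
  have hcard : activeCount I.n m₁ ≤ I.n :=
    (Finset.card_filter_le _ _).trans (Finset.card_range _).le
  -- Every round labels at least one active vertex, so `n` rounds suffice.
  have main := forLoop_induction (n := I.n) (f := fun _ => forLoop I.n (pivotStep I.n)) (m := m₁)
    (fun i m => IsPivoting I.n m₀ m ∧ (activeCount I.n m = 0 ∨ activeCount I.n m + i ≤ I.n))
    ⟨hp, .inr hcard⟩ (fun i hi m hm => by
      obtain ⟨h1, h2⟩ := pivotRound_spec hH hc hm.1
      exact ⟨h1, by omega⟩)
  refine ⟨main.1, fun v hv h0 => ?_⟩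
  have h0' : activeCount I.n (forLoop I.n (fun _ => forLoop I.n (pivotStep I.n)) m₁) = 0 := by omega
  have := Finset.card_eq_zero.1 h0'
  have hmem : v ∈ (∅ : Finset ℕ) := by
    rw [← this]
    simp [hv, h0]
  simp at hmem

/-- Packing followed by pivoting. -/
theorem run_pack_pivot (I : CCInstance) (r : ℕ → ℕ) (m₀ : Memory)
    (hH : IsGraphMatrix I.n (m₀ 2)) :
    let l := fun v => (LoopProg.seq packProg pivotProg).run I r m₀ 4 v 0
    (∀ u < I.n, ∀ v < I.n, (∀ k < I.n, m₀ 2 k u = m₀ 2 k v) → l u = l v) ∧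
      ∀ l' : ℕ → ℕ, pairSum I.n (mistake (m₀ 2) l) ≤ 9 * pairSum I.n (mistake (m₀ 2) l') := by
  obtain ⟨h1, h2⟩ := run_packProg I r m₀ hH
  have e2 : packProg.run I r m₀ 2 = m₀ 2 := h1.frame 2 (by norm_num)
  obtain ⟨h3, h4⟩ := run_pivotProg I r (packProg.run I r m₀) (by rwa [e2]) (by rwa [e2])
  refine ⟨fun u hu v hv h => h3.twin u hu v hv (by rwa [e2]), fun l' => ?_⟩
  -- The ratio 9 is 3 times 3: mistakes of the pivoting against marks, and marks against mistakes of
  -- `l'`. Every pair is settled at the end, and marks are at most 1.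
  have h5 := h3.sum_le
  rw [e2] at h5
  have h6 := h1.sum_le l'
  have hs : ∀ i < I.n, ∀ j < I.n, settled (pivotProg.run I r (packProg.run I r m₀)) i j = 1 := by
    intro i hi j hj
    have := h4 i hi
    exact if_neg (by omega)
  have h8 : pairSum I.n (fun i j => settled (pivotProg.run I r (packProg.run I r m₀)) i j *
      mistake (m₀ 2) (fun v => pivotProg.run I r (packProg.run I r m₀) 4 v 0) i j) =
      pairSum I.n (mistake (m₀ 2) fun v => pivotProg.run I r (packProg.run I r m₀) 4 v 0) :=
    pairSum_congr fun i hi j hj => by rw [hs i hi j hj, one_mul]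
  have h9 : pairSum I.n (fun i j => settled (pivotProg.run I r (packProg.run I r m₀)) i j *
      packProg.run I r m₀ 3 i j) = pairSum I.n (packProg.run I r m₀ 3) :=
    pairSum_congr fun i hi j hj => by rw [hs i hi j hj, one_mul]
  have h7 : pairSum I.n (fun i j => packProg.run I r m₀ 3 i j * mistake (m₀ 2) l' i j) ≤
      pairSum I.n (mistake (m₀ 2) l') :=
    pairSum_le fun i hi j hj => by
      simpa using Nat.mul_le_mul_right (mistake (m₀ 2) l' i j) (h1.le_one i hi j hj)
  change pairSum I.n (mistake (m₀ 2) fun v =>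
      pivotProg.run I r (packProg.run I r m₀) 4 v 0) ≤ _
  omega

end Pivot

/-! ### Splitting fair sets into small fair sets -/

theorem lex_trichotomy {V : Type*} [LinearOrder V] (c : V → ℕ) {u v : V} (h : u ≠ v) :
    (c u < c v ∨ c u = c v ∧ u < v) ∨ (c v < c u ∨ c v = c u ∧ v < u) := by
  rcases lt_trichotomy (c u) (c v) with h1 | h1 | h1
  · exact .inl (.inl h1)
  · rcases lt_or_gt_of_ne h with h2 | h2
    · exact .inl (.inr ⟨h1, h2⟩)
    · exact .inr (.inr ⟨h1.symm, h2⟩)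
  · exact .inr (.inl h1)

section Fairlet

variable {V : Type*} [Fintype V] {t : ℕ} {l c : V → ℕ}

/-- Size of the set of a vertex, for the partition given by the labelling `l`. -/
def classSize (l : V → ℕ) (v : V) : ℕ := (Finset.univ.filter fun u => l u = l v).card

theorem classSize_congr {u v : V} (h : l u = l v) : classSize l u = classSize l v := by
  simp only [classSize, h]

/-- Fairness of the partition given by a labelling. -/
def IsFairLabelling (t : ℕ) (l c : V → ℕ) : Prop :=
  ∀ v k, t * (Finset.univ.filter fun u => l u = l v ∧ c u = k).card ≤ classSize l v

theorem IsFairLabelling.le_classSize (h : IsFairLabelling t l c) (v : V) :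
    t ≤ classSize l v := by
  refine le_trans ?_ (h v (c v))
  refine Nat.le_mul_of_pos_right _ (Finset.card_pos.2 ⟨v, by simp⟩)

variable [LinearOrder V]

/-- Rank of a vertex in its set, which is sorted by colours. -/
def classRank (l c : V → ℕ) (v : V) : ℕ :=
  (Finset.univ.filter fun u => l u = l v ∧ (c u < c v ∨ c u = c v ∧ u < v)).card

/-- The vertices of a set are dealt out to as many fairlets as possible, in the order of their
ranks. -/
def fairletIndex (t : ℕ) (l c : V → ℕ) (v : V) : ℕ := classRank l c v % (classSize l v / t)

/-- Two vertices are in the same fairlet. -/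
def SameFairlet (t : ℕ) (l c : V → ℕ) (u v : V) : Prop :=
  l u = l v ∧ fairletIndex t l c u = fairletIndex t l c v

instance (t : ℕ) (l c : V → ℕ) (u v : V) : Decidable (SameFairlet t l c u v) :=
  inferInstanceAs (Decidable (_ ∧ _))

theorem SameFairlet.refl (v : V) : SameFairlet t l c v v := ⟨rfl, rfl⟩

theorem SameFairlet.symm {u v : V} (h : SameFairlet t l c u v) : SameFairlet t l c v u :=
  ⟨h.1.symm, h.2.symm⟩

theorem SameFairlet.trans {u v w : V} (h : SameFairlet t l c u v) (h' : SameFairlet t l c v w) :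
    SameFairlet t l c u w :=
  ⟨h.1.trans h'.1, h.2.trans h'.2⟩

theorem classRank_lt_classSize (v : V) : classRank l c v < classSize l v := by
  refine Finset.card_lt_card (Finset.ssubset_iff_of_subset (fun u hu => ?_) |>.2 ⟨v, by simp, ?_⟩)
  · simp only [Finset.mem_filter, Finset.mem_univ, true_and] at hu ⊢
    exact hu.1
  · simp

theorem classRank_lt {u v : V} (h : l u = l v) (huv : c u < c v ∨ c u = c v ∧ u < v) :
    classRank l c u < classRank l c v := by
  refine Finset.card_lt_card (Finset.ssubset_iff_of_subset (fun w hw => ?_) |>.2 ⟨u, ?_, by simp⟩)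
  · simp only [Finset.mem_filter, Finset.mem_univ, true_and] at hw ⊢
    refine ⟨hw.1.trans h, ?_⟩
    rcases hw.2 with h1 | ⟨h1, h2⟩ <;> rcases huv with h3 | ⟨h3, h4⟩
    · exact .inl (h1.trans h3)
    · exact .inl (h3 ▸ h1)
    · exact .inl (h1 ▸ h3)
    · exact .inr ⟨h1.trans h3, h2.trans h4⟩
  · simpa [h] using huv

theorem classRank_injOn (v : V) :
    Set.InjOn (classRank l c) (Finset.univ.filter fun u => l u = l v : Finset V) := by
  intro u hu w hw h
  simp only [Finset.coe_filter, Finset.mem_univ, true_and, Set.mem_ofPred_eq] at hu hw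
  by_contra hne
  rcases lex_trichotomy c hne with h1 | h1
  · exact (classRank_lt (hu.trans hw.symm) h1).ne h
  · exact (classRank_lt (hw.trans hu.symm) h1).ne' h

theorem image_classRank (v : V) :
    (Finset.univ.filter fun u => l u = l v).image (classRank l c) =
      Finset.range (classSize l v) := by
  refine Finset.eq_of_subset_of_card_le (fun i hi => ?_) ?_
  · obtain ⟨u, hu, rfl⟩ := Finset.mem_image.1 hi
    simp only [Finset.mem_filter, Finset.mem_univ, true_and] at hu
    rw [Finset.mem_range, ← classSize_congr hu]
    exact classRank_lt_classSize u
  · rw [Finset.card_image_of_injOn (classRank_injOn v), Finset.card_range]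
    rfl

/-- Ranks number a set from 0 to its size minus 1, so a fairlet corresponds to a residue class
modulo the number of fairlets. -/
theorem card_sameFairlet (v : V) : (Finset.univ.filter fun u => SameFairlet t l c u v).card =
    ((Finset.range (classSize l v)).filter
      fun i => i % (classSize l v / t) = fairletIndex t l c v).card := by
  rw [← image_classRank (c := c), Finset.filter_image, Finset.card_image_of_injOn]
  · rw [Finset.filter_filter]
    congr 1
    refine Finset.filter_congr fun u _ => ?_
    refine and_congr_right fun h => ?_
    rw [fairletIndex, classSize_congr h]
  · exact (classRank_injOn v).mono fun u hu => by
      simp only [Finset.coe_filter, Finset.mem_filter] at hu ⊢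
      exact hu.1

/-- The numbers `r + m * j` with `j < t` are all below `t * m`. -/
theorem card_filter_mod_ge {s m r t : ℕ} (hr : r < m) (h : t * m ≤ s) :
    t ≤ ((Finset.range s).filter fun i => i % m = r).card := by
  calc t = ((Finset.range t).image fun j => r + m * j).card := by
        rw [Finset.card_image_of_injective, Finset.card_range]
        intro a b hab
        exact Nat.eq_of_mul_eq_mul_left (by omega : 0 < m) (by simpa using hab)
    _ ≤ _ := Finset.card_le_card fun i hi => by
        obtain ⟨j, hj, rfl⟩ := Finset.mem_image.1 hi
        rw [Finset.mem_range] at hj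
        rw [Finset.mem_filter, Finset.mem_range, Nat.add_mul_mod_self_left, Nat.mod_eq_of_lt hr]
        refine ⟨?_, rfl⟩
        have : (j + 1) * m ≤ t * m := Nat.mul_le_mul_right _ hj
        rw [add_mul, one_mul, mul_comm j m] at this
        omega

/-- A number of given residue is determined by its quotient, which is less than `q`. -/
theorem card_filter_mod_le {s m r q : ℕ} (h : s ≤ q * m) :
    ((Finset.range s).filter fun i => i % m = r).card ≤ q := by
  calc _ = (((Finset.range s).filter fun i => i % m = r).image fun i => i / m).card := by
        rw [Finset.card_image_of_injOn]
        intro a ha b hb hab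
        simp only [Finset.coe_filter, Set.mem_ofPred_eq] at ha hb
        rw [← Nat.div_add_mod a m, ← Nat.div_add_mod b m, ha.2, hb.2]
        simp only at hab
        rw [hab]
    _ ≤ (Finset.range q).card := Finset.card_le_card fun i hi => by
        obtain ⟨j, hj, rfl⟩ := Finset.mem_image.1 hi
        rw [Finset.mem_filter, Finset.mem_range] at hj
        rw [Finset.mem_range]
        exact Nat.div_lt_of_lt_mul (by rw [mul_comm]; omega)
    _ = q := Finset.card_range q

theorem IsFairLabelling.le_card_sameFairlet (h : IsFairLabelling t l c) (ht : 1 ≤ t) (v : V) :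
    t ≤ (Finset.univ.filter fun u => SameFairlet t l c u v).card := by
  rw [card_sameFairlet]
  exact card_filter_mod_ge (Nat.mod_lt _ (Nat.div_pos (h.le_classSize v) ht))
    (Nat.mul_div_le _ _)

/-- With `m` the number of fairlets, the set has fewer than `t * (m + 1)` vertices, and this is at
most `2 * t * m` because `m ≥ 1`. -/
theorem IsFairLabelling.card_sameFairlet_le (h : IsFairLabelling t l c) (ht : 1 ≤ t) (v : V) :
    (Finset.univ.filter fun u => SameFairlet t l c u v).card ≤ 2 * t := by
  rw [card_sameFairlet]
  refine card_filter_mod_le ?_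
  have h1 := Nat.div_pos (h.le_classSize v) ht
  have h2 := Nat.lt_mul_div_succ (classSize l v) ht
  have h3 : t * 1 ≤ t * (classSize l v / t) := Nat.mul_le_mul_left _ h1
  linarith

/-- Every colour occurs at most once in a fairlet. -/
theorem IsFairLabelling.eq_of_sameFairlet (h : IsFairLabelling t l c) (ht : 1 ≤ t) {u v : V}
    (huv : SameFairlet t l c u v) (hc : c u = c v) : u = v := by
  have aux : ∀ u v : V, u < v → SameFairlet t l c u v → c u = c v → False := by
    intro u v hlt huv hc
    have h1 := classRank_lt (c := c) huv.1 (.inr ⟨hc, hlt⟩)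
    set A := Finset.univ.filter fun w => l w = l u ∧ c w = c u with hA
    -- Sorting by colour puts the colour class `A` on consecutive ranks. By fairness it has at most
    -- as many elements as there are fairlets, so two distinct ranks in it cannot be congruent.
    have h2 : classRank l c v < classRank l c u + A.card := by
      have hu : u ∈ A := by simp [hA]
      have hv : v ∈ A := by simp [hA, huv.1, hc]
      calc classRank l c v ≤ ((Finset.univ.filter
            fun w => l w = l u ∧ (c w < c u ∨ c w = c u ∧ w < u)) ∪ A.erase v).card := by
            refine Finset.card_le_card fun w hw => ?_
            simp only [Finset.mem_filter, Finset.mem_univ, true_and, Finset.mem_union,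
              Finset.mem_erase, hA] at hw ⊢
            rw [← huv.1, ← hc] at hw
            rcases hw.2 with h3 | h3
            · exact .inl ⟨hw.1, .inl h3⟩
            · exact .inr ⟨h3.2.ne, hw.1, h3.1⟩
        _ ≤ classRank l c u + (A.erase v).card := Finset.card_union_le _ _
        _ < classRank l c u + A.card := by
            have := Finset.card_erase_lt_of_mem hv
            omega
    have h3 : A.card ≤ classSize l u / t := by
      rw [Nat.le_div_iff_mul_le ht, mul_comm]
      exact h u (c u)
    have h4 : classRank l c u ≡ classRank l c v [MOD classSize l u / t] := by
      have := huv.2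
      unfold fairletIndex at this
      rwa [← classSize_congr huv.1] at this
    have h5 := (Nat.modEq_iff_dvd' h1.le).1 h4
    have := Nat.le_of_dvd (by omega) h5
    omega
  by_contra hne
  rcases lt_or_gt_of_ne hne with h1 | h1
  · exact aux u v h1 huv hc
  · exact aux v u h1 huv.symm hc.symm

/-- Unions of fairlets are fair. -/
theorem IsFairLabelling.coarsen (h : IsFairLabelling t l c) (ht : 1 ≤ t) {l' : V → ℕ}
    (hl : ∀ u v, SameFairlet t l c u v → l' u = l' v) : IsFairLabelling t l' c := by
  intro v k
  -- Replace each vertex of colour `k` by its whole fairlet. These fairlets are disjoint, since a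
  -- fairlet contains a colour at most once, and they stay inside the coarse class.
  calc t * (Finset.univ.filter fun u => l' u = l' v ∧ c u = k).card
      = ∑ u ∈ Finset.univ.filter (fun u => l' u = l' v ∧ c u = k), t := by
        rw [Finset.sum_const, smul_eq_mul, mul_comm]
    _ ≤ ∑ u ∈ Finset.univ.filter (fun u => l' u = l' v ∧ c u = k),
          (Finset.univ.filter fun w => SameFairlet t l c w u).card :=
        Finset.sum_le_sum fun u _ => h.le_card_sameFairlet ht u
    _ = ((Finset.univ.filter fun u => l' u = l' v ∧ c u = k).biUnion
          fun u => Finset.univ.filter fun w => SameFairlet t l c w u).card := by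
        rw [Finset.card_biUnion]
        intro u hu u' hu' hne
        simp only [Finset.coe_filter, Finset.mem_univ, true_and, Set.mem_ofPred_eq] at hu hu'
        refine Finset.disjoint_left.2 fun w hw hw' => hne ?_
        simp only [Finset.mem_filter, Finset.mem_univ, true_and] at hw hw'
        exact h.eq_of_sameFairlet ht (hw.symm.trans hw') (hu.2.trans hu'.2.symm)
    _ ≤ classSize l' v := Finset.card_le_card fun w hw => by
        simp only [Finset.mem_biUnion, Finset.mem_filter, Finset.mem_univ, true_and] at hw ⊢
        obtain ⟨u, hu, hw⟩ := hw
        exact (hl w u hw).trans hu.1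

end Fairlet

/-! ### The programs for fairlets and for the graph between them -/

section FairletProg

open LoopExpr LoopProg

/-- Division of one column by another (or by a constant), where the quotients are at most `n`. -/
def divExpr (e f : LoopExpr) : LoopExpr :=
  .sum 2 (.bin .lt (.sum 3 (.ite (.bin .lt (.var 3) (.bin .add (.var 2) (.const 1))) f (.const 0)))
    (.bin .add (.const 1) e))

theorem sum_range_ite_lt (n a b : ℕ) (h : a ≤ n) :
    (∑ i ∈ Finset.range n, if i < a then b else 0) = a * b := by
  rw [← Finset.sum_filter, Finset.sum_const, smul_eq_mul]
  congr 1
  rw [show (Finset.range n).filter (fun i => i < a) = Finset.range a by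
    ext i
    simp only [Finset.mem_filter, Finset.mem_range]
    omega, Finset.card_range]

theorem ite_one_zero_ne_zero (p : Prop) [Decidable p] : ((if p then 1 else 0 : ℕ) ≠ 0) = p := by
  simp

/-- The quotient is the number of `i` with `(i + 1) * b ≤ a`, where the product is itself computed
as a sum. Since `a ≤ n`, no such `i` is lost by letting it range below `n`. -/
theorem eval_divExpr (I : CCInstance) (m : Memory) (r : ℕ → ℕ) (e f : LoopExpr) (a b : ℕ)
    (he : ∀ i, e.eval I m (Function.update r 2 i) = a)
    (hf : ∀ i j, f.eval I m (Function.update (Function.update r 2 i) 3 j) = b)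
    (hb : 0 < b) (ha : a ≤ I.n) : (divExpr e f).eval I m r = a / b := by
  have h1 : ∀ i, i < I.n → (∑ j ∈ Finset.range I.n, if j < i + 1 then b else 0) = (i + 1) * b :=
    fun i hi => sum_range_ite_lt _ _ _ hi
  simp only [divExpr, LoopExpr.eval, he, hf, BinOp.eval_lt, BinOp.eval_add, ite_one_zero_ne_zero]
  simp only [Function.update_self, ne_eq, Nat.reduceEqDiff,
    not_false_eq_true, Function.update_of_ne]
  rw [Finset.sum_congr rfl (g := fun i => if i < a / b then 1 else 0)
    fun i hi => by
      rw [h1 i (Finset.mem_range.1 hi)]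
      refine if_congr ?_ rfl rfl
      rw [Nat.lt_one_add_iff, ← Nat.le_div_iff_mul_le hb]
      exact Iff.rfl]
  rw [sum_range_ite_lt _ _ _ ((Nat.div_le_self _ _).trans ha), mul_one]

theorem run_column (I : CCInstance) (r : ℕ → ℕ) (m : Memory) (a : ℕ) (e : LoopExpr) (f : ℕ → ℕ)
    (he : ∀ m' : Memory, (∀ b, b ≠ a → m' b = m b) → ∀ i < I.n,
      e.eval I m' (Function.update r 0 i) = f i) :
    let m' := (LoopProg.for 0 (.store a (.var 0) (.const 0) e)).run I r m
    (∀ b, b ≠ a → m' b = m b) ∧ ∀ i < I.n, m' a i 0 = f i := by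
  refine forLoop_induction (n := I.n) (m := m)
    (fun i m' => (∀ b, b ≠ a → m' b = m b) ∧ ∀ j < i, m' a j 0 = f j)
    ⟨fun _ _ => rfl, fun _ h => absurd h (by omega)⟩ fun i hi m' hm' => ?_
  have hrun : (LoopProg.store a (.var 0) (.const 0) e).run I (Function.update r 0 i) m' =
      m'.set a i 0 (f i) := by
    simp only [LoopProg.run, LoopExpr.eval, he m' hm'.1 i hi, Function.update_self]
  rw [hrun]
  refine ⟨fun b hb => ?_, fun j hj => ?_⟩
  · rw [← hm'.1 b hb]
    funext x y
    simp [Memory.set, hb]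
  · by_cases hji : j = i
    · simp [Memory.set, hji]
    · simpa [Memory.set, hji] using hm'.2 j (by omega)

theorem run_table (I : CCInstance) (r : ℕ → ℕ) (m : Memory) (a : ℕ) (e : LoopExpr)
    (f : ℕ → ℕ → ℕ) (he : ∀ m' : Memory, (∀ b, b ≠ a → m' b = m b) → ∀ i < I.n, ∀ j < I.n,
      e.eval I m' (Function.update (Function.update r 0 i) 1 j) = f i j) :
    let m' := (LoopProg.for 0 (.for 1 (.store a (.var 0) (.var 1) e))).run I r m
    (∀ b, b ≠ a → m' b = m b) ∧ ∀ i < I.n, ∀ j < I.n, m' a i j = f i j := by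
  refine forLoop_induction (n := I.n) (m := m)
    (fun i m' => (∀ b, b ≠ a → m' b = m b) ∧ ∀ i' < i, ∀ j < I.n, m' a i' j = f i' j)
    ⟨fun _ _ => rfl, fun _ h => absurd h (by omega)⟩ (fun i hi m₁ h₁ => ?_)
  have hstep : ∀ j < I.n, ∀ m' : Memory, (∀ b, b ≠ a → m' b = m b) →
      (LoopProg.store a (.var 0) (.var 1) e).run I (Function.update (Function.update r 0 i) 1 j) m'
        = m'.set a i j (f i j) := by
    intro j hj m' hm'
    simp only [LoopProg.run, LoopExpr.eval, he m' hm' i hi j hj, Function.update_self,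
      ne_eq, zero_ne_one, not_false_eq_true, Function.update_of_ne]
  have h := forLoop_induction (n := I.n) (m := m₁)
    (f := fun j => (LoopProg.store a (.var 0) (.var 1) e).run I
      (Function.update (Function.update r 0 i) 1 j))
    (fun j m' => (∀ b, b ≠ a → m' b = m b) ∧ (∀ i' < i, ∀ j < I.n, m' a i' j = f i' j) ∧
      ∀ j' < j, m' a i j' = f i j')
    ⟨h₁.1, h₁.2, fun _ h => absurd h (by omega)⟩ (fun j hj m' hm' => by
      rw [hstep j hj m' hm'.1]
      refine ⟨fun b hb => ?_, fun i' hi' j' hj' => ?_, fun j' hj' => ?_⟩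
      · rw [← hm'.1 b hb]
        funext x y
        simp [Memory.set, hb]
      · simpa [Memory.set, hi'.ne] using hm'.2.1 i' hi' j' hj'
      · by_cases hji : j' = j
        · simp [Memory.set, hji]
        · simpa [Memory.set, hji] using hm'.2.2 j' (by omega))
  refine ⟨h.1, fun i' hi' j hj => ?_⟩
  rcases Nat.lt_succ_iff_lt_or_eq.1 hi' with h' | rfl
  · exact h.2.1 i' h' j hj
  · exact h.2.2 j hj

/-- Size of the set of the vertex in the variable `0`. -/
def sizeExpr : LoopExpr :=
  .sum 1 (.bin .eq (.bin (.load 0) (.var 1) (.const 0)) (.bin (.load 0) (.var 0) (.const 0)))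

/-- Rank of the vertex in the variable `0`. -/
def rankExpr : LoopExpr :=
  .sum 1 (.ite (.bin .eq (.bin (.load 0) (.var 1) (.const 0)) (.bin (.load 0) (.var 0) (.const 0)))
    (.ite (.bin .lt (.bin .color (.var 1) (.const 0)) (.bin .color (.var 0) (.const 0))) (.const 1)
      (.ite (.bin .eq (.bin .color (.var 1) (.const 0)) (.bin .color (.var 0) (.const 0)))
        (.bin .lt (.var 1) (.var 0)) (.const 0))) (.const 0))

/-- Writes the indices of fairlets to array `1`, for the partition of array `0`. -/
def indexProg (t : ℕ) : LoopProg :=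
  .seq (.for 0 (.store 5 (.var 0) (.const 0) (divExpr sizeExpr (.const t))))
    (.seq (.for 0 (.store 6 (.var 0) (.const 0) rankExpr))
      (.seq (.for 0 (.store 7 (.var 0) (.const 0) (divExpr (.bin (.load 6) (.var 0) (.const 0))
        (.bin (.load 5) (.var 0) (.const 0)))))
        (.for 0 (.store 1 (.var 0) (.const 0) (.bin .sub (.bin (.load 6) (.var 0) (.const 0))
          (.sum 2 (.ite (.bin .lt (.var 2) (.bin (.load 7) (.var 0) (.const 0)))
            (.bin (.load 5) (.var 0) (.const 0)) (.const 0))))))))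

theorem eval_sizeExpr (I : CCInstance) (m : Memory) (r : ℕ → ℕ) (v : Fin I.n) (hr : r 0 = v) :
    sizeExpr.eval I m r = classSize (fun u : Fin I.n => m 0 u 0) v := by
  simp only [sizeExpr, LoopExpr.eval, BinOp.eval_eq, BinOp.eval_load, Function.update_self, ne_eq,
    zero_ne_one, not_false_eq_true, Function.update_of_ne, hr]
  rw [Finset.sum_range, classSize, Finset.card_filter]

theorem eval_rankExpr (I : CCInstance) (m : Memory) (r : ℕ → ℕ) (v : Fin I.n) (hr : r 0 = v) :
    rankExpr.eval I m r = classRank (fun u : Fin I.n => m 0 u 0) I.color v := by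
  simp only [rankExpr, LoopExpr.eval, BinOp.eval_eq, BinOp.eval_load, BinOp.eval_lt,
    Function.update_self, ite_one_zero_ne_zero, Function.update_of_ne (zero_ne_one (α := ℕ)), hr]
  rw [Finset.sum_range, classRank, Finset.card_filter]
  refine Finset.sum_congr rfl fun u _ => ?_
  simp only [BinOp.eval_color, Fin.lt_def]
  split_ifs <;> first | rfl | (exfalso; tauto)

/-- Array 5 receives the number of fairlets of the set of a vertex, array 6 its rank, array 7 their
quotient, and array 1 the remainder. Fairness makes the divisor positive. -/
theorem run_indexProg (I : CCInstance) (r : ℕ → ℕ) (m : Memory) {t : ℕ} (ht : 1 ≤ t)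
    (h : IsFairLabelling t (fun u : Fin I.n => m 0 u 0) I.color) :
    (indexProg t).run I r m 0 = m 0 ∧ ∀ v : Fin I.n,
      (indexProg t).run I r m 1 v 0 = fairletIndex t (fun u : Fin I.n => m 0 u 0) I.color v := by
  have hsize : ∀ v, classSize (fun u : Fin I.n => m 0 u 0) v ≤ I.n := fun v =>
    (Finset.card_filter_le _ _).trans (by simp)
  have c1 := run_column I r m 5 (divExpr sizeExpr (.const t))
    (fun i => if hi : i < I.n then classSize (fun u : Fin I.n => m 0 u 0) ⟨i, hi⟩ / t else 0)
    (fun m' hm' i hi => by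
      rw [dif_pos hi]
      refine eval_divExpr _ _ _ _ _ _ _ (fun j => ?_) (fun _ _ => rfl) ht (hsize _)
      rw [eval_sizeExpr _ _ _ ⟨i, hi⟩ (by simp), hm' 0 (by norm_num)])
  obtain ⟨f1, v1⟩ := c1
  set m1 := (LoopProg.for 0 (.store 5 (.var 0) (.const 0) (divExpr sizeExpr (.const t)))).run I r m
    with hm1
  obtain ⟨f2, v2⟩ := run_column I r m1 6 rankExpr
    (fun i => if hi : i < I.n then classRank (fun u : Fin I.n => m 0 u 0) I.color ⟨i, hi⟩ else 0)
    (fun m' hm' i hi => by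
      rw [dif_pos hi, eval_rankExpr _ _ _ ⟨i, hi⟩ (by simp), hm' 0 (by norm_num),
        f1 0 (by norm_num)])
  set m2 := (LoopProg.for 0 (.store 6 (.var 0) (.const 0) rankExpr)).run I r m1 with hm2
  have e5 : ∀ v : Fin I.n, m2 5 v 0 = classSize (fun u : Fin I.n => m 0 u 0) v / t := fun v => by
    rw [f2 5 (by norm_num), v1 v v.2, dif_pos v.2]
  have e6 : ∀ v : Fin I.n, m2 6 v 0 = classRank (fun u : Fin I.n => m 0 u 0) I.color v := fun v => by
    rw [v2 v v.2, dif_pos v.2]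
  have hq : ∀ v : Fin I.n, m2 6 v 0 / m2 5 v 0 ≤ I.n := fun v => by
    rw [e6]
    exact (Nat.div_le_self _ _).trans ((classRank_lt_classSize v).le.trans (hsize v))
  obtain ⟨f3, v3⟩ := run_column I r m2 7 (divExpr (.bin (.load 6) (.var 0) (.const 0))
        (.bin (.load 5) (.var 0) (.const 0))) (fun i => m2 6 i 0 / m2 5 i 0)
    (fun m' hm' i hi => by
      refine eval_divExpr _ _ _ _ _ _ _ (fun j => ?_) (fun j k => ?_) ?_ ?_
      · simp [LoopExpr.eval, BinOp.eval_load, hm' 6 (by norm_num)]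
      · simp [LoopExpr.eval, BinOp.eval_load, hm' 5 (by norm_num)]
      · rw [e5 ⟨i, hi⟩]
        exact Nat.div_pos (h.le_classSize _) ht
      · rw [e6 ⟨i, hi⟩]
        exact (classRank_lt_classSize _).le.trans (hsize _))
  set m3 := (LoopProg.for 0 (.store 7 (.var 0) (.const 0) (divExpr
    (.bin (.load 6) (.var 0) (.const 0)) (.bin (.load 5) (.var 0) (.const 0))))).run I r m2 with hm3
  obtain ⟨f4, v4⟩ := run_column I r m3 1 (.bin .sub (.bin (.load 6) (.var 0) (.const 0))
          (.sum 2 (.ite (.bin .lt (.var 2) (.bin (.load 7) (.var 0) (.const 0)))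
            (.bin (.load 5) (.var 0) (.const 0)) (.const 0)))) (fun i => m2 6 i 0 % m2 5 i 0)
    (fun m' hm' i hi => by
      simp only [LoopExpr.eval, BinOp.eval_load, BinOp.eval_lt, BinOp.eval_sub,
        ite_one_zero_ne_zero, Function.update_self,
        Function.update_of_ne (two_ne_zero (α := ℕ)).symm,
        hm' 6 (by norm_num), hm' 7 (by norm_num), hm' 5 (by norm_num)]
      rw [v3 i hi, f3 6 (by norm_num), f3 5 (by norm_num),
        sum_range_ite_lt _ _ _ (hq ⟨i, hi⟩), Nat.mod_eq_sub_div_mul])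
  refine ⟨?_, fun v => ?_⟩
  · exact (f4 0 (by norm_num)).trans ((f3 0 (by norm_num)).trans ((f2 0 (by norm_num)).trans
      (f1 0 (by norm_num))))
  · refine (v4 v v.2).trans ?_
    rw [e5, e6, fairletIndex]

/-- Are two vertices in the same fairlet? -/
def sameExpr (x y : ℕ) : LoopExpr :=
  .ite (.bin .eq (.bin (.load 0) (.var x) (.const 0)) (.bin (.load 0) (.var y) (.const 0)))
    (.bin .eq (.bin (.load 1) (.var x) (.const 0)) (.bin (.load 1) (.var y) (.const 0))) (.const 0)

/-- Number of pairs of a vertex in the fairlet of the variable `0` and a vertex in the fairlet of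
the variable `1` that satisfy a condition. -/
def countExpr (e : LoopExpr) : LoopExpr :=
  .sum 2 (.sum 3 (.ite (sameExpr 2 0) (.ite (sameExpr 3 1) e (.const 0)) (.const 0)))

/-- Writes the majority graph of the fairlets to array `2`. -/
def majorityProg : LoopProg :=
  .for 0 (.for 1 (.store 2 (.var 0) (.var 1) (.ite (sameExpr 0 1) (.const 1)
    (.bin .lt (countExpr (.bin .eq (.bin .adj (.var 2) (.var 3)) (.const 0)))
      (.bin .add (.const 1) (countExpr (.bin .adj (.var 2) (.var 3))))))))

/-! ### Majority graph of a partition into blocks -/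

section Majority

variable {V : Type*} [Fintype V]

open Classical in
/-- Number of pairs of a vertex related to `u` and a vertex related to `v` that satisfy `q`. -/
noncomputable def blockCount (s q : V → V → Prop) (u v : V) : ℕ :=
  ∑ u', ∑ v', if s u' u ∧ s v' v ∧ q u' v' then 1 else 0

open Classical in
/-- The majority graph: vertices in the same block are adjacent, and vertices in different blocks
are adjacent if at least half of the pairs between the blocks are. -/
noncomputable def majority (s q : V → V → Prop) (u v : V) : ℕ :=
  if s u v ∨ blockCount s (fun a b => ¬ q a b) u v ≤ blockCount s q u v then 1 else 0

end Majority

theorem run_majorityProg (I : CCInstance) (r : ℕ → ℕ) (m : Memory) {t : ℕ}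
    (h : ∀ v : Fin I.n, m 1 v 0 = fairletIndex t (fun u : Fin I.n => m 0 u 0) I.color v)
    (u v : Fin I.n) : majorityProg.run I r m 2 u v =
      majority (SameFairlet t (fun u : Fin I.n => m 0 u 0) I.color) I.pos.Adj u v := by
  classical
  have hsame : ∀ (m' : Memory), (∀ b, b ≠ 2 → m' b = m b) → ∀ (x y : ℕ) (r' : ℕ → ℕ)
      (a b : Fin I.n), r' x = a → r' y = b → (sameExpr x y).eval I m' r' =
      if SameFairlet t (fun u : Fin I.n => m 0 u 0) I.color a b then 1 else 0 := by
    intro m' hm' x y r' a b hx hy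
    simp only [sameExpr, LoopExpr.eval, BinOp.eval_eq, BinOp.eval_load, ite_one_zero_ne_zero,
      hx, hy, hm' 0 (by norm_num), hm' 1 (by norm_num), h]
    simp only [SameFairlet]
    split_ifs <;> simp_all
  have hcount : ∀ (m' : Memory), (∀ b, b ≠ 2 → m' b = m b) → ∀ (e : LoopExpr) (r' : ℕ → ℕ)
      (q : Fin I.n → Fin I.n → Prop) (a b : Fin I.n), r' 0 = a → r' 1 = b →
      (∀ i j : Fin I.n, e.eval I m' (Function.update (Function.update r' 2 i) 3 j) =
        if q i j then 1 else 0) → (countExpr e).eval I m' r' =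
        blockCount (SameFairlet t (fun u : Fin I.n => m 0 u 0) I.color) q a b := by
    intro m' hm' e r' q a b ha hb he
    simp only [countExpr, LoopExpr.eval]
    rw [Finset.sum_range, blockCount]
    refine Finset.sum_congr rfl fun i _ => ?_
    rw [Finset.sum_range]
    refine Finset.sum_congr rfl fun j _ => ?_
    rw [hsame m' hm' 2 0 _ i a (by simp) (by simp [ha]),
      hsame m' hm' 3 1 _ j b (by simp) (by simp [hb]), he]
    simp only [ite_one_zero_ne_zero]
    split_ifs <;> first | rfl | (exfalso; tauto)
  obtain ⟨-, h2⟩ := run_table I r m 2 (.ite (sameExpr 0 1) (.const 1)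
    (.bin .lt (countExpr (.bin .eq (.bin .adj (.var 2) (.var 3)) (.const 0)))
      (.bin .add (.const 1) (countExpr (.bin .adj (.var 2) (.var 3))))))
    (fun i j => if hij : i < I.n ∧ j < I.n then
      majority (SameFairlet t (fun u : Fin I.n => m 0 u 0) I.color) I.pos.Adj ⟨i, hij.1⟩ ⟨j, hij.2⟩
      else 0) (fun m' hm' i hi j hj => by
      rw [dif_pos ⟨hi, hj⟩, LoopExpr.eval, LoopExpr.eval, LoopExpr.eval, LoopExpr.eval,
        hsame m' hm' 0 1 _ ⟨i, hi⟩ ⟨j, hj⟩ (by simp) (by simp),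
        hcount m' hm' _ _ (fun a b => ¬ I.pos.Adj a b) ⟨i, hi⟩ ⟨j, hj⟩ (by simp) (by simp)
          (fun a b => by
            simp only [LoopExpr.eval, BinOp.eval_eq]
            simp [BinOp.eval_adj]),
        hcount m' hm' _ _ I.pos.Adj ⟨i, hi⟩ ⟨j, hj⟩ (by simp) (by simp)
          (fun a b => by
            simp only [LoopExpr.eval]
            simp [BinOp.eval_adj])]
      simp only [BinOp.eval_lt, BinOp.eval_add, ite_one_zero_ne_zero, majority, Nat.lt_one_add_iff,
        LoopExpr.eval]
      split_ifs <;> first | rfl | (exfalso; tauto))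
  refine (h2 u u.2 v v.2).trans (dif_pos ⟨u.2, v.2⟩)

end FairletProg

/-! ### The majority graph is close to the positive graph -/

open Classical in
/-- Adjacency matrix of a graph with loops added at all vertices. -/
noncomputable def closedAdj {V : Type*} (q : V → V → Prop) (u v : V) : ℕ :=
  if u = v ∨ q u v then 1 else 0

open Classical in
theorem closedAdj_comm {V : Type*} {q : V → V → Prop} (hq : ∀ u v, q u v → q v u) (u v : V) :
    closedAdj q u v = closedAdj q v u := by
  unfold closedAdj
  congr 1
  exact propext ⟨fun h => h.imp Eq.symm (hq _ _), fun h => h.imp Eq.symm (hq _ _)⟩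

section Majority

variable {V : Type*} [Fintype V]

/-- Distance of two rows of the adjacency matrix with loops. -/
noncomputable def rowDist (q : V → V → Prop) (u v : V) : ℕ :=
  ∑ w, if closedAdj q u w = closedAdj q v w then 0 else 1

open Classical in
/-- Sum of the distances of the rows within the blocks of a relation. -/
noncomputable def blockDist (s q : V → V → Prop) : ℕ :=
  ∑ u, ∑ v, if s u v then rowDist q u v else 0

open Classical in
-- Because of the loops, the rows of two distinct nonadjacent vertices differ at both of these
-- vertices.
theorem two_le_rowDist {q : V → V → Prop} (hq : ∀ u v, q u v → q v u) {u v : V} (huv : u ≠ v)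
    (h : ¬ q u v) : 2 ≤ rowDist q u v := by
  have h' : ¬ q v u := fun h' => h (hq _ _ h')
  have hle : ∑ w ∈ ({u, v} : Finset V), (if closedAdj q u w = closedAdj q v w then 0 else 1) ≤
      rowDist q u v :=
    Finset.sum_le_sum_of_subset (Finset.subset_univ _)
  rw [Finset.sum_pair huv] at hle
  simpa [closedAdj, huv, huv.symm, h, h'] using hle

open Classical in
theorem blockCount_add (s q : V → V → Prop) (u v : V) :
    blockCount s q u v + blockCount s (fun a b => ¬ q a b) u v =
      (Finset.univ.filter fun u' => s u' u).card * (Finset.univ.filter fun v' => s v' v).card := by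
  simp only [blockCount, Finset.card_filter, Finset.sum_mul_sum, ← Finset.sum_add_distrib]
  refine Finset.sum_congr rfl fun a _ => Finset.sum_congr rfl fun b _ => ?_
  by_cases h1 : s a u <;> by_cases h2 : s b v <;> by_cases h3 : q a b <;> simp [h1, h2, h3]

open Classical in
-- If the majority overrules the pair `(u, v)`, then at least half of the pairs between the two
-- blocks disagree with it. The blocks are disjoint, so loops play no role.
theorem card_mul_card_le_of_majority_ne {s q : V → V → Prop} (hs : Equivalence s) {u v : V}
    (huv : ¬ s u v) (h : majority s q u v ≠ closedAdj q u v) :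
    (Finset.univ.filter fun u' => s u' u).card * (Finset.univ.filter fun v' => s v' v).card ≤
      2 * ∑ u', ∑ v', if s u' u ∧ s v' v ∧ closedAdj q u v ≠ closedAdj q u' v' then 1 else 0 := by
  have hne : ∀ a b, s a u → s b v → a ≠ b := by
    rintro a b ha hb rfl
    exact huv (hs.trans (hs.symm ha) hb)
  have key : ∀ p : V → V → Prop, (∀ a b, a ≠ b → p a b → closedAdj q u v ≠ closedAdj q a b) →
      blockCount s p u v ≤
        ∑ u', ∑ v', if s u' u ∧ s v' v ∧ closedAdj q u v ≠ closedAdj q u' v' then 1 else 0 := by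
    intro p hp
    refine Finset.sum_le_sum fun a _ => Finset.sum_le_sum fun b _ => ?_
    by_cases h1 : s a u ∧ s b v ∧ p a b
    · rw [if_pos h1, if_pos ⟨h1.1, h1.2.1, hp a b (hne a b h1.1 h1.2.1) h1.2.2⟩]
    · rw [if_neg h1]
      exact Nat.zero_le _
  have hadd := blockCount_add s q u v
  have huv' : u ≠ v := hne u v (hs.refl u) (hs.refl v)
  by_cases hq : q u v
  · have h1 : closedAdj q u v = 1 := if_pos (.inr hq)
    have h2 := key (fun a b => ¬ q a b) fun a b hab hp => by
      rw [h1, closedAdj, if_neg (by tauto)]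
      norm_num
    have h3 : ¬ blockCount s (fun a b => ¬ q a b) u v ≤ blockCount s q u v := fun h3 =>
      h (by rw [h1, majority, if_pos (.inr h3)])
    omega
  · have h1 : closedAdj q u v = 0 := if_neg (by tauto)
    have h2 := key q fun a b hab hp => by
      rw [h1, closedAdj, if_pos (.inr hp)]
      norm_num
    have h3 : blockCount s (fun a b => ¬ q a b) u v ≤ blockCount s q u v := by
      by_contra h3
      exact h (by rw [h1, majority, if_neg (by tauto)])
    omega

open Classical in
/-- Pairs of blocks with different entries. -/
theorem sum_block_ne_le {s q : V → V → Prop} (hs : Equivalence s) (hq : ∀ u v, q u v → q v u)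
    {b : ℕ} (hb : ∀ v, (Finset.univ.filter fun u => s u v).card ≤ b) :
    (∑ u, ∑ v, ∑ u', ∑ v', if s u' u ∧ s v' v ∧ closedAdj q u v ≠ closedAdj q u' v' then 1 else 0)
      ≤ 2 * b * blockDist s q := by
  -- Pass from `(u, v)` to `(u', v')` through `(u', v)`, changing one end at a time. The idle end of
  -- each change contributes a factor of at most `b`.
  have h1 : (∑ u, ∑ v, ∑ u', ∑ v', if s u' u ∧ s v' v ∧ closedAdj q u v ≠ closedAdj q u' v'
      then 1 else 0) ≤ ∑ u, ∑ v, ∑ u', ∑ v',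
      ((if s u' u then if closedAdj q u v = closedAdj q u' v then 0 else 1 else 0) *
        (if s v' v then 1 else 0) + (if s u' u then 1 else 0) *
        (if s v' v then if closedAdj q u' v = closedAdj q u' v' then 0 else 1 else 0)) := by
    refine Finset.sum_le_sum fun u _ => Finset.sum_le_sum fun v _ => Finset.sum_le_sum fun u' _ =>
      Finset.sum_le_sum fun v' _ => ?_
    by_cases h1 : s u' u <;> by_cases h2 : s v' v <;> simp only [h1, h2, true_and, false_and,
      if_true, if_false, zero_mul, mul_zero, le_refl, one_mul, mul_one, add_zero]
    split_ifs <;> omega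
  refine h1.trans ?_
  simp only [Finset.sum_add_distrib]
  have h2 : (∑ u, ∑ v, ∑ u', ∑ v',
      (if s u' u then if closedAdj q u v = closedAdj q u' v then 0 else 1 else 0) *
        (if s v' v then 1 else 0)) ≤ b * blockDist s q := by
    simp only [← Finset.mul_sum, ← Finset.sum_mul, ← Finset.card_filter]
    calc _ ≤ ∑ u, ∑ v, (∑ u', if s u' u then if closedAdj q u v = closedAdj q u' v then 0 else 1
            else 0) * b :=
          Finset.sum_le_sum fun u _ => Finset.sum_le_sum fun v _ => Nat.mul_le_mul_left _ (hb v)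
      _ = b * blockDist s q := by
          simp only [← Finset.sum_mul]
          rw [mul_comm]
          congr 1
          refine Finset.sum_congr rfl fun u _ => ?_
          rw [Finset.sum_comm]
          refine Finset.sum_congr rfl fun u' _ => ?_
          rw [if_congr (Iff.intro hs.symm hs.symm : s u u' ↔ s u' u) rfl rfl]
          split_ifs <;> simp [rowDist]
  have h3 : (∑ u, ∑ v, ∑ u', ∑ v', (if s u' u then 1 else 0) *
      (if s v' v then if closedAdj q u' v = closedAdj q u' v' then 0 else 1 else 0)) ≤
      b * blockDist s q := by
    simp only [← Finset.mul_sum]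
    calc _ = ∑ u', ∑ u, ∑ v, (if s u' u then 1 else 0) * ∑ v',
          (if s v' v then if closedAdj q u' v = closedAdj q u' v' then 0 else 1 else 0) := by
          rw [Finset.sum_congr rfl fun u _ => Finset.sum_comm, Finset.sum_comm]
      _ ≤ ∑ u', b * ∑ v, ∑ v',
          (if s v' v then if closedAdj q u' v = closedAdj q u' v' then 0 else 1 else 0) := by
          refine Finset.sum_le_sum fun u' _ => ?_
          simp only [← Finset.mul_sum, ← Finset.sum_mul]
          refine Nat.mul_le_mul_right _ ?_
          rw [← Finset.card_filter]
          refine le_trans (le_of_eq ?_) (hb u')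
          congr 1
          ext u
          simp only [Finset.mem_filter, Finset.mem_univ, true_and]
          exact ⟨hs.symm, hs.symm⟩
      _ = b * blockDist s q := by
          rw [← Finset.mul_sum]
          congr 1
          rw [Finset.sum_comm]
          refine Finset.sum_congr rfl fun v _ => ?_
          rw [Finset.sum_comm]
          refine Finset.sum_congr rfl fun v' _ => ?_
          rw [if_congr (Iff.intro hs.symm hs.symm : s v v' ↔ s v' v) rfl rfl]
          split_ifs
          · refine Finset.sum_congr rfl fun u' _ => ?_
            rw [closedAdj_comm hq u' v, closedAdj_comm hq u' v']
          · simp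
  linarith

open Classical in
/-- The majority graph differs from the given one in few pairs, if the rows of each block are close
to each other. -/
theorem sum_majority_ne_le {s q : V → V → Prop} (hs : Equivalence s) (hq : ∀ u v, q u v → q v u)
    {t : ℕ} (ht : 1 ≤ t) (hl : ∀ v, t ≤ (Finset.univ.filter fun u => s u v).card)
    (hb : ∀ v, (Finset.univ.filter fun u => s u v).card ≤ 2 * t) :
    2 * t * (∑ u, ∑ v, if majority s q u v = closedAdj q u v then 0 else 1) ≤
      (t + 16) * blockDist s q := by
  -- Inside a block the majority entry is 1, so an error is a missing edge, and the rows of its ends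
  -- differ at least twice.
  have h1 : 2 * (∑ u, ∑ v, if s u v ∧ majority s q u v ≠ closedAdj q u v then 1 else 0) ≤
      blockDist s q := by
    simp only [Finset.mul_sum]
    refine Finset.sum_le_sum fun u _ => Finset.sum_le_sum fun v _ => ?_
    by_cases h : s u v ∧ majority s q u v ≠ closedAdj q u v
    · rw [if_pos h, if_pos h.1, mul_one]
      have h2 := h.2
      rw [majority, if_pos (.inl h.1), closedAdj] at h2
      split_ifs at h2 with h3
      · exact absurd rfl h2
      · exact two_le_rowDist hq (fun e => h3 (.inl e)) fun e => h3 (.inr e)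
    · rw [if_neg h]
      exact Nat.zero_le _
  -- Between blocks, each error is charged to at least half of at least `t * t` pairs; summing uses
  -- `sum_block_ne_le` with block size at most `2 * t`.
  have h2 : t * t * (∑ u, ∑ v, if ¬ s u v ∧ majority s q u v ≠ closedAdj q u v then 1 else 0) ≤
      2 * (2 * (2 * t) * blockDist s q) := by
    refine le_trans ?_ (Nat.mul_le_mul_left 2 (sum_block_ne_le hs hq hb))
    simp only [Finset.mul_sum (s := Finset.univ) (a := t * t)]
    rw [Finset.mul_sum]
    refine Finset.sum_le_sum fun u _ => ?_
    rw [Finset.mul_sum]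
    refine Finset.sum_le_sum fun v _ => ?_
    by_cases h : ¬ s u v ∧ majority s q u v ≠ closedAdj q u v
    · rw [if_pos h, mul_one]
      exact (Nat.mul_le_mul (hl u) (hl v)).trans (card_mul_card_le_of_majority_ne hs h.1 h.2)
    · rw [if_neg h, mul_zero]
      exact Nat.zero_le _
  have h3 : (∑ u, ∑ v, if majority s q u v = closedAdj q u v then 0 else 1) =
      (∑ u, ∑ v, if s u v ∧ majority s q u v ≠ closedAdj q u v then 1 else 0) +
      (∑ u, ∑ v, if ¬ s u v ∧ majority s q u v ≠ closedAdj q u v then 1 else 0) := by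
    simp only [← Finset.sum_add_distrib]
    refine Finset.sum_congr rfl fun u _ => Finset.sum_congr rfl fun v _ => ?_
    by_cases h : s u v <;> simp [h]
  rw [h3]
  generalize (∑ u, ∑ v, if s u v ∧ majority s q u v ≠ closedAdj q u v then 1 else 0) = a at *
  generalize (∑ u, ∑ v, if ¬ s u v ∧ majority s q u v ≠ closedAdj q u v then 1 else 0) = c at *
  have h4 : t * c ≤ 8 * blockDist s q := by
    refine Nat.le_of_mul_le_mul_left ?_ ht
    linarith
  have h5 : t * (2 * a) ≤ t * blockDist s q := Nat.mul_le_mul_left _ h1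
  linarith

open Classical in
theorem majority_comm {s q : V → V → Prop} (hs : Equivalence s) (hq : ∀ u v, q u v → q v u)
    (u v : V) : majority s q u v = majority s q v u := by
  have h : ∀ p : V → V → Prop, (∀ u v, p u v → p v u) →
      blockCount s p u v = blockCount s p v u := by
    intro p hp
    unfold blockCount
    rw [Finset.sum_comm]
    refine Finset.sum_congr rfl fun a _ => Finset.sum_congr rfl fun b _ => ?_
    exact if_congr ⟨fun h => ⟨h.2.1, h.1, hp _ _ h.2.2⟩,
      fun h => ⟨h.2.1, h.1, hp _ _ h.2.2⟩⟩ rfl rfl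
  unfold majority
  rw [h q hq, h (fun a b => ¬ q a b) fun a b h h' => h (hq _ _ h')]
  exact if_congr (or_congr ⟨hs.symm, hs.symm⟩ Iff.rfl) rfl rfl

open Classical in
-- Vertices of one block are twins in the majority graph, so pivoting keeps fairlets together.
theorem majority_congr {s q : V → V → Prop} (hs : Equivalence s) {u v : V} (h : s u v) (w : V) :
    majority s q w u = majority s q w v := by
  have h0 : ∀ x, s x u ↔ s x v :=
    fun x => ⟨fun h' => hs.trans h' h, fun h' => hs.trans h' (hs.symm h)⟩
  have h1 : ∀ p : V → V → Prop, blockCount s p w u = blockCount s p w v := fun p =>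
    Finset.sum_congr rfl fun a _ => Finset.sum_congr rfl fun b _ =>
      if_congr (and_congr_right fun _ => and_congr_left fun _ => h0 b) rfl rfl
  unfold majority
  rw [h1, h1]
  exact if_congr (or_congr_left (h0 w)) rfl rfl

end Majority

/-! ### Costs of clusterings -/

namespace CCInstance

variable (I : CCInstance)

open Classical in
/-- Number of ordered pairs that a relation treats wrongly. -/
noncomputable def errors (s : Fin I.n → Fin I.n → Prop) : ℕ :=
  ∑ u, ∑ v, if closedAdj I.pos.Adj u v = (if s u v then 1 else 0) then 0 else 1

theorem isIntra_mk (P : I.Clustering) (u v : Fin I.n) :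
    I.IsIntra P s(u, v) ↔ v ∈ P.part u := by
  constructor
  · rintro ⟨S, hS, h⟩
    have hu := h u (by simp)
    rw [P.part_eq_of_mem hS hu]
    exact h v (by simp)
  · intro h
    refine ⟨P.part u, P.part_mem.2 (Finset.mem_univ u), ?_⟩
    simp only [Sym2.mem_iff, forall_eq_or_imp, forall_eq]
    exact ⟨P.mem_part (Finset.mem_univ u), h⟩

open Classical in
theorem two_mul_ncard_edgeSet {V : Type*} [Fintype V] (G : SimpleGraph V) :
    2 * G.edgeSet.ncard = ∑ u, ∑ v, if G.Adj u v then 1 else 0 := by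
  rw [← SimpleGraph.coe_edgeFinset, Set.ncard_coe_finset, ← G.sum_degrees_eq_twice_card_edges]
  refine Finset.sum_congr rfl fun u _ => ?_
  rw [← Finset.card_filter, ← SimpleGraph.card_neighborFinset_eq_degree]
  congr 1
  ext v
  simp

open Classical in
theorem two_mul_ccCost (P : I.Clustering) :
    2 * I.ccCost P = I.errors fun u v => v ∈ P.part u := by
  have hsymm : ∀ u v, v ∈ P.part u → u ∈ P.part v := fun u v h => by
    rw [← isIntra_mk] at h ⊢
    rwa [Sym2.eq_swap]
  let G₁ : SimpleGraph (Fin I.n) :=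
    { Adj := fun u v => I.posᶜ.Adj u v ∧ v ∈ P.part u
      symm := ⟨fun u v h => ⟨h.1.symm, hsymm u v h.2⟩⟩
      loopless := ⟨fun u h => h.1.ne rfl⟩ }
  let G₂ : SimpleGraph (Fin I.n) :=
    { Adj := fun u v => I.pos.Adj u v ∧ v ∉ P.part u
      symm := ⟨fun u v h => ⟨h.1.symm, fun h' => h.2 (hsymm v u h')⟩⟩
      loopless := ⟨fun u h => h.1.ne rfl⟩ }
  have e₁ : {e | e ∈ I.posᶜ.edgeSet ∧ I.IsIntra P e} = G₁.edgeSet := by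
    ext e
    induction e with
    | _ u v => exact and_congr_right fun _ => isIntra_mk I P u v
  have e₂ : {e | e ∈ I.pos.edgeSet ∧ ¬ I.IsIntra P e} = G₂.edgeSet := by
    ext e
    induction e with
    | _ u v => exact and_congr_right fun _ => not_congr (isIntra_mk I P u v)
  have h : 2 * G₁.edgeSet.ncard + 2 * G₂.edgeSet.ncard = I.errors fun u v => v ∈ P.part u := by
    rw [two_mul_ncard_edgeSet, two_mul_ncard_edgeSet, errors, ← Finset.sum_add_distrib]
    refine Finset.sum_congr rfl fun u _ => ?_
    rw [← Finset.sum_add_distrib]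
    refine Finset.sum_congr rfl fun v _ => ?_
    simp only [G₁, G₂, SimpleGraph.compl_adj, closedAdj]
    by_cases huv : u = v
    · subst huv
      simp
    · by_cases h1 : I.pos.Adj u v <;> by_cases h2 : v ∈ P.part u <;> simp [huv, h1, h2]
  rw [ccCost, e₁, e₂, ← h]
  push_cast
  ring

theorem bddBelow_medianCost (S : Finset (Fin I.n)) :
    BddBelow (Set.range fun x : I.Cube => ∑ v ∈ S, I.cubeDist x (I.embed v)) := by
  refine ⟨0, ?_⟩
  rintro _ ⟨x, rfl⟩
  exact Finset.sum_nonneg fun v _ => Finset.sum_nonneg fun u _ => abs_nonneg _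

theorem embed_eq_closedAdj (u v : Fin I.n) :
    ((I.embed u v : Set.Icc (0 : ℝ) 1) : ℝ) = closedAdj I.pos.Adj u v := by
  unfold embed closedAdj
  split_ifs <;> simp

theorem sum_parts_eq {M : Type*} [AddCommMonoid M] (P : I.Clustering) (f : Fin I.n → M) :
    ∑ S ∈ P.parts, ∑ v ∈ S, f v = ∑ v, f v := by
  refine (Finset.sum_biUnion P.supIndep.pairwiseDisjoint).symm.trans ?_
  refine Finset.sum_congr ?_ fun _ _ => rfl
  simpa [Finset.sup_eq_biUnion] using P.sup_parts

/-- Take the indicator of each set as the candidate median: its distance to the row of a member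
counts the wrong pairs at that vertex. Ordered pairs account for the factor 2. -/
theorem medianCost_le (P : I.Clustering) : I.medianCost P ≤ 2 * I.ccCost P := by
  classical
  rw [two_mul_ccCost, errors, Nat.cast_sum, ← sum_parts_eq I P]
  refine Finset.sum_le_sum fun S hS => ?_
  refine (ciInf_le (I.bddBelow_medianCost S) fun u => if u ∈ S then 1 else 0).trans (le_of_eq ?_)
  refine Finset.sum_congr rfl fun v hv => ?_
  rw [Nat.cast_sum]
  refine Finset.sum_congr rfl fun u _ => ?_
  rw [embed_eq_closedAdj, P.part_eq_of_mem hS hv]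
  unfold closedAdj
  split_ifs <;> simp_all

theorem cubeDist_triangle (x y z : I.Cube) : I.cubeDist y z ≤ I.cubeDist x y + I.cubeDist x z := by
  unfold cubeDist
  rw [← Finset.sum_add_distrib]
  refine Finset.sum_le_sum fun v _ => ?_
  rw [abs_sub_comm (x v : ℝ) (y v)]
  exact abs_sub_le _ _ _

theorem cubeDist_embed (u v : Fin I.n) :
    I.cubeDist (I.embed u) (I.embed v) = rowDist I.pos.Adj u v := by
  unfold cubeDist rowDist
  rw [Nat.cast_sum]
  refine Finset.sum_congr rfl fun w _ => ?_
  rw [embed_eq_closedAdj, embed_eq_closedAdj]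
  unfold closedAdj
  split_ifs <;> simp_all

/-- The rows of the blocks of a refinement are close to each other if the median cost is small. -/
theorem blockDist_le_medianCost (P : I.Clustering) {s : Fin I.n → Fin I.n → Prop}
    (hs : Equivalence s) (hsP : ∀ u v, s u v → v ∈ P.part u) {b : ℕ}
    (hb : ∀ v, ({u | s u v} : Set (Fin I.n)).ncard ≤ b) :
    (blockDist s I.pos.Adj : ℝ) ≤ 2 * b * I.medianCost P := by
  classical
  have hb' : ∀ v, (Finset.univ.filter fun u => s u v).card ≤ b := fun v => by
    rw [← Set.ncard_coe_finset]
    simpa using hb v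
  rw [blockDist, Nat.cast_sum, ← sum_parts_eq I P, medianCost, Finset.mul_sum]
  refine Finset.sum_le_sum fun S hS => ?_
  rw [medianCostSet, Real.mul_iInf_of_nonneg (by positivity)]
  -- The bound is shown for every centre `x`. Each related pair goes through `x`, and each vertex
  -- occurs in at most `b` pairs on either side, whence `2 * b`.
  refine le_ciInf fun x => ?_
  have h1 : ∀ u ∈ S, ((∑ v, if s u v then rowDist I.pos.Adj u v else 0 : ℕ) : ℝ) ≤
      ∑ v ∈ S, if s u v then I.cubeDist x (I.embed u) + I.cubeDist x (I.embed v) else 0 := by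
    intro u hu
    rw [← Finset.sum_subset (Finset.subset_univ S), Nat.cast_sum]
    · refine Finset.sum_le_sum fun v _ => ?_
      split_ifs
      · rw [← cubeDist_embed]
        exact I.cubeDist_triangle _ _ _
      · simp
    · intro v _ hv
      rw [if_neg]
      intro h
      exact hv (P.part_eq_of_mem hS hu ▸ hsP u v h)
  have h0 : ∀ u, 0 ≤ I.cubeDist x (I.embed u) := fun u =>
    Finset.sum_nonneg fun u _ => abs_nonneg _
  have h2 : ∀ u, ∑ v ∈ S, (if s u v then I.cubeDist x (I.embed u) else 0) ≤
      b * I.cubeDist x (I.embed u) := by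
    intro u
    rw [← Finset.sum_filter, Finset.sum_const, nsmul_eq_mul]
    refine mul_le_mul_of_nonneg_right ?_ (h0 u)
    rw [Nat.cast_le]
    refine le_trans (Finset.card_le_card fun v hv => ?_) (hb' u)
    simp only [Finset.mem_filter, Finset.mem_univ, true_and] at hv ⊢
    exact hs.symm hv.2
  calc _ ≤ ∑ u ∈ S, ∑ v ∈ S,
        (if s u v then I.cubeDist x (I.embed u) + I.cubeDist x (I.embed v) else 0) :=
        Finset.sum_le_sum h1
    _ = ∑ u ∈ S, ∑ v ∈ S, (if s u v then I.cubeDist x (I.embed u) else 0) +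
        ∑ u ∈ S, ∑ v ∈ S, (if s u v then I.cubeDist x (I.embed v) else 0) := by
        simp only [← Finset.sum_add_distrib]
        refine Finset.sum_congr rfl fun u _ => Finset.sum_congr rfl fun v _ => ?_
        split_ifs <;> simp
    _ = ∑ u ∈ S, ∑ v ∈ S, (if s u v then I.cubeDist x (I.embed u) else 0) +
        ∑ u ∈ S, ∑ v ∈ S, (if s u v then I.cubeDist x (I.embed u) else 0) := by
        congr 1
        rw [Finset.sum_comm]
        refine Finset.sum_congr rfl fun u _ => Finset.sum_congr rfl fun v _ => ?_
        exact if_congr ⟨hs.symm, hs.symm⟩ rfl rfl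
    _ ≤ ∑ u ∈ S, b * I.cubeDist x (I.embed u) + ∑ u ∈ S, b * I.cubeDist x (I.embed u) :=
        add_le_add (Finset.sum_le_sum fun u _ => h2 u) (Finset.sum_le_sum fun u _ => h2 u)
    _ = 2 * b * ∑ v ∈ S, I.cubeDist x (I.embed v) := by
        rw [← Finset.mul_sum]
        ring

end CCInstance

/-! ### The algorithm -/

/-- Splits the clusters of array `0` into small fairlets, and clusters the majority graph of the
fairlets. -/
def fairClusterProg (t : ℕ) : LoopProg :=
  .seq (indexProg t) (.seq majorityProg (.seq (.seq packProg pivotProg)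
    (.for 0 (.store 0 (.var 0) (.const 0) (.bin (.load 4) (.var 0) (.const 0))))))

/-- The parameter `t` enters the program only as a constant, and all constants cost the same. Hence
one polynomial serves for all `t`. -/
theorem cost_fairClusterProg (t : ℕ) : (fairClusterProg t).cost = (fairClusterProg 0).cost := rfl

theorem equivalence_sameFairlet {V : Type*} [Fintype V] [LinearOrder V] (t : ℕ) (l c : V → ℕ) :
    Equivalence (SameFairlet t l c) :=
  ⟨SameFairlet.refl, SameFairlet.symm, SameFairlet.trans⟩

/-! ### Comparing the errors on two graphs -/

section Errors

variable {V : Type*} [Fintype V]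

/-- Number of ordered pairs of a graph, given by its matrix, that a labelling treats wrongly. -/
def matrixErrors (H : V → V → ℕ) (l : V → ℕ) : ℕ :=
  ∑ u, ∑ v, if H u v = (if l u = l v then 1 else 0) then 0 else 1

/-- Triangle inequality for the Hamming distance between `H`, `G` and the matrix of the labelling.
-/
theorem matrixErrors_le (H G : V → V → ℕ) (l : V → ℕ) :
    matrixErrors H l ≤ matrixErrors G l + ∑ u, ∑ v, if H u v = G u v then 0 else 1 := by
  unfold matrixErrors
  simp only [← Finset.sum_add_distrib]
  refine Finset.sum_le_sum fun u _ => Finset.sum_le_sum fun v _ => ?_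
  generalize (if l u = l v then 1 else 0 : ℕ) = x
  split_ifs <;> omega

end Errors

theorem pairSum_mistake {n : ℕ} {H : ℕ → ℕ → ℕ} {H' : Fin n → Fin n → ℕ}
    (hH : ∀ u v : Fin n, H u v = H' u v) (l : ℕ → ℕ) :
    pairSum n (mistake H l) = matrixErrors H' fun v => l v := by
  unfold pairSum matrixErrors mistake
  rw [Finset.sum_range]
  refine Finset.sum_congr rfl fun u _ => ?_
  rw [Finset.sum_range]
  exact Finset.sum_congr rfl fun v _ => by rw [hH]

/-- The majority matrix is symmetric with unit diagonal, so `run_pack_pivot` applies to it; its twin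
property turns `majority_congr` into labels that are constant on fairlets. -/
theorem run_fairClusterProg (I : CCInstance) (r : ℕ → ℕ) (m : Memory) {t : ℕ} (ht : 1 ≤ t)
    (h : IsFairLabelling t (fun u : Fin I.n => m 0 u 0) I.color) :
    let s := SameFairlet t (fun u : Fin I.n => m 0 u 0) I.color
    let l := fun v : Fin I.n => (fairClusterProg t).run I r m 0 v 0
    (∀ u v, s u v → l u = l v) ∧ ∀ l' : Fin I.n → ℕ,
      matrixErrors (majority s I.pos.Adj) l ≤ 9 * matrixErrors (majority s I.pos.Adj) l' := by
  intro s l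
  have hs : Equivalence s := equivalence_sameFairlet _ _ _
  have hq : ∀ u v, I.pos.Adj u v → I.pos.Adj v u := fun _ _ h => h.symm
  obtain ⟨e0, e1⟩ := run_indexProg I r m ht h
  have hM := run_majorityProg I r ((indexProg t).run I r m) (by rwa [e0])
  rw [e0] at hM
  set m₂ := majorityProg.run I r ((indexProg t).run I r m) with hm₂
  have hH : IsGraphMatrix I.n (m₂ 2) := by
    refine ⟨fun i hi j hj => ?_, fun i hi => ?_, fun i hi j hj => ?_⟩
    · rw [hM ⟨i, hi⟩ ⟨j, hj⟩, majority]
      split_ifs <;> simp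
    · rw [hM ⟨i, hi⟩ ⟨i, hi⟩, majority, if_pos (.inl (hs.refl _))]
    · rw [hM ⟨i, hi⟩ ⟨j, hj⟩, hM ⟨j, hj⟩ ⟨i, hi⟩, majority_comm hs hq]
  obtain ⟨h1, h2⟩ := run_pack_pivot I r m₂ hH
  obtain ⟨-, hl⟩ := run_column I r ((LoopProg.seq packProg pivotProg).run I r m₂) 0
    (.bin (.load 4) (.var 0) (.const 0))
    (fun v => (LoopProg.seq packProg pivotProg).run I r m₂ 4 v 0)
    (fun m' hm' i hi => by
      simp only [LoopExpr.eval, BinOp.eval_load, hm' 4 (by norm_num), Function.update_self])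
  have hl' : ∀ v : Fin I.n, l v = (LoopProg.seq packProg pivotProg).run I r m₂ 4 v 0 :=
    fun v => hl v v.2
  refine ⟨fun u v huv => ?_, fun l' => ?_⟩
  · rw [hl', hl']
    refine h1 u u.2 v v.2 fun k hk => ?_
    rw [hM ⟨k, hk⟩ u, hM ⟨k, hk⟩ v]
    exact majority_congr hs huv _
  · have h3 := h2 fun v => if hv : v < I.n then l' ⟨v, hv⟩ else 0
    rw [pairSum_mistake hM, pairSum_mistake hM] at h3
    simpa only [← hl', Fin.is_lt, dif_pos, Fin.eta] using h3

namespace RamState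

theorem mem_part_output (I : CCInstance) (s : RamState) (u v : Fin I.n) :
    v ∈ (s.output I).part u ↔ s.mem 0 u 0 = s.mem 0 v 0 := by
  classical
  unfold output
  rw [Finpartition.mem_part_ofSetoid_iff_rel]
  exact Iff.rfl

theorem isFair_output_iff (I : CCInstance) (s : RamState) {t : ℕ} (ht : 1 ≤ t) :
    I.IsFair (1 / (t : ℝ)) (s.output I) ↔
      IsFairLabelling t (fun u : Fin I.n => s.mem 0 u 0) I.color := by
  have hpart : ∀ v, (s.output I).part v =
      Finset.univ.filter fun u : Fin I.n => s.mem 0 u 0 = s.mem 0 v 0 := by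
    intro v
    ext u
    rw [mem_part_output]
    simp [eq_comm]
  have ht' : (0 : ℝ) < t := by exact_mod_cast ht
  have key : ∀ v k, ((((s.output I).part v).filter fun u => I.color u = k).card : ℝ) ≤
      1 / (t : ℝ) * ((s.output I).part v).card ↔
      t * (Finset.univ.filter fun u : Fin I.n =>
        s.mem 0 u 0 = s.mem 0 v 0 ∧ I.color u = k).card ≤
        classSize (fun u : Fin I.n => s.mem 0 u 0) v := by
    intro v k
    rw [hpart, Finset.filter_filter, one_div, ← div_eq_inv_mul, le_div_iff₀ ht', mul_comm]
    exact_mod_cast Iff.rfl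
  constructor
  · intro h v k
    exact (key v k).1 (h _ ((s.output I).part_mem.2 (Finset.mem_univ v)) k)
  · intro h S hS k
    obtain ⟨v, hv⟩ := (s.output I).nonempty_of_mem_parts hS
    rw [← (s.output I).part_eq_of_mem hS hv]
    exact (key v k).2 (h v k)

end RamState

theorem CCInstance.errors_eq_matrixErrors (I : CCInstance) (P : I.Clustering) (l : Fin I.n → ℕ)
    (hl : ∀ u v, v ∈ P.part u ↔ l u = l v) :
    2 * I.ccCost P = matrixErrors (closedAdj I.pos.Adj) l := by
  rw [I.two_mul_ccCost, errors, matrixErrors]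
  simp only [hl]

/-- Every clustering is given by a labelling. -/
theorem CCInstance.exists_labelling (I : CCInstance) (P : I.Clustering) :
    ∃ l : Fin I.n → ℕ, ∀ u v, v ∈ P.part u ↔ l u = l v := by
  refine ⟨fun u => Encodable.encode (P.part u), fun u v => ?_⟩
  rw [Encodable.encode_inj]
  exact (P.mem_part_iff_part_eq_part (Finset.mem_univ v) (Finset.mem_univ u)).trans eq_comm

/-- The clustering of the fairlets is cheap, if the given fairlet decomposition is. -/
theorem ccCost_fairClusterProg_le (I : CCInstance) (r : ℕ → ℕ) (s s' : RamState) {t : ℕ}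
    (ht : 1 ≤ t) (h : IsFairLabelling t (fun u : Fin I.n => s.mem 0 u 0) I.color)
    (hs' : s'.mem = (fairClusterProg t).run I r s.mem) (Q : I.Clustering) :
    I.ccCost (s'.output I) ≤ 9 * I.ccCost Q + 170 * t * I.medianCost (s.output I) := by
  obtain ⟨l', hl'⟩ := I.exists_labelling Q
  have hrun := (run_fairClusterProg I r s.mem ht h).2 l'
  set S := SameFairlet t (fun u : Fin I.n => s.mem 0 u 0) I.color with hS
  have hE : Equivalence S := equivalence_sameFairlet _ _ _
  have hq : ∀ u v, I.pos.Adj u v → I.pos.Adj v u := fun _ _ h => h.symm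
  have hcost := I.errors_eq_matrixErrors (s'.output I) _ fun u v => s'.mem_part_output I u v
  have hcostQ := I.errors_eq_matrixErrors Q l' hl'
  rw [hs'] at hcost
  set l := fun v : Fin I.n => (fairClusterProg t).run I r s.mem 0 v 0
  set d := ∑ u, ∑ v, if majority S I.pos.Adj u v = closedAdj I.pos.Adj u v then 0 else 1 with hd
  have hd' : (∑ u, ∑ v, if closedAdj I.pos.Adj u v = majority S I.pos.Adj u v then 0 else 1) =
      d := by
    simp only [hd, eq_comm]
  have h1 := matrixErrors_le (closedAdj I.pos.Adj) (majority S I.pos.Adj) l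
  have h2 := matrixErrors_le (majority S I.pos.Adj) (closedAdj I.pos.Adj) l'
  rw [hd'] at h1
  -- The change of graph costs `d` for the computed labelling, and 9 times `d` for the competitor.
  have h3 : matrixErrors (closedAdj I.pos.Adj) l ≤
      9 * matrixErrors (closedAdj I.pos.Adj) l' + 10 * d := by omega
  have h4 : 2 * t * d ≤ (t + 16) * blockDist S I.pos.Adj := by
    refine sum_majority_ne_le hE hq ht (fun v => ?_) fun v => ?_
    · convert h.le_card_sameFairlet ht v
    · convert h.card_sameFairlet_le ht v
  have h5 := I.blockDist_le_medianCost (s.output I) hE (fun u v huv =>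
    (s.mem_part_output I u v).2 huv.1) (b := 2 * t) (fun v => by
      have := h.card_sameFairlet_le ht v
      rw [← Set.ncard_coe_finset] at this
      simpa using this)
  have h6 : (2 * t * d : ℝ) ≤ (t + 16) * blockDist S I.pos.Adj := by exact_mod_cast h4
  have h7 : (matrixErrors (closedAdj I.pos.Adj) l : ℝ) ≤
      9 * matrixErrors (closedAdj I.pos.Adj) l' + 10 * d := by exact_mod_cast h3
  have ht' : (1 : ℝ) ≤ t := by exact_mod_cast ht
  have hB : (0 : ℝ) ≤ blockDist S I.pos.Adj := Nat.cast_nonneg _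
  push_cast at h5
  -- Here `34 = 17 * 4 / 2`. Since the cost is half the number of errors, the final constant is `10
  -- * 34 / 2 = 170`.
  have h8 : (2 * t * d : ℝ) ≤ 2 * t * (34 * t * I.medianCost (s.output I)) := by
    calc (2 * t * d : ℝ) ≤ (t + 16) * blockDist S I.pos.Adj := h6
      _ ≤ (17 * t) * blockDist S I.pos.Adj := mul_le_mul_of_nonneg_right (by linarith) hB
      _ ≤ (17 * t) * (2 * (2 * t) * I.medianCost (s.output I)) :=
          mul_le_mul_of_nonneg_left h5 (by positivity)
      _ = _ := by ring
  have h9 := le_of_mul_le_mul_left h8 (by positivity)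
  linarith

theorem mainTheorem5 :
    ∃ (K : ℝ) (q : Polynomial ℕ), ∀ (t : ℕ), 1 ≤ t → ∀ (γ : ℝ), 1 ≤ γ →
      ∀ (A : RamProg) (T : CCInstance → ℕ),
        IsMedianFairletApproxAlgorithm (1 / (t : ℝ)) γ A T →
          ∃ B : RamProg,
            IsFairCCApproxAlgorithm (1 / (t : ℝ)) (K * ((t : ℝ) * γ)) B
              (fun I => T I + q.eval I.n) := by
  -- The constant is `9 + 170 * 2`, where the 2 comes from `medianCost_le`.
  refine ⟨349, (fairClusterProg 0).cost, fun t ht γ hγ A T hA =>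
    ⟨.seq A ((fairClusterProg t).compile (fairClusterProg t).bound), fun I => ?_⟩⟩
  obtain ⟨s, k, hk, hkT, hs⟩ := hA I
  -- The second program starts from whatever registers and arrays the first one left behind; its
  -- specification holds for all of them, as the arrays it uses are overwritten before being read,
  -- except for the labels in array 0.
  obtain ⟨s', k', hk', hkq, hm, -⟩ :=
    (fairClusterProg t).exec_compile I (fairClusterProg t).bound s le_rfl
  rw [cost_fairClusterProg] at hkq
  refine ⟨s', k + k', .seq hk hk', Nat.add_le_add hkT hkq, fun hQ => ?_⟩
  obtain ⟨hfair, hopt⟩ := hs hQ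
  rw [RamState.isFair_output_iff I s ht] at hfair
  refine ⟨?_, fun Q hQf => ?_⟩
  · rw [RamState.isFair_output_iff I s' ht, hm]
    exact hfair.coarsen ht (run_fairClusterProg I s.reg s.mem ht hfair).1
  · have h1 := ccCost_fairClusterProg_le I s.reg s s' ht hfair hm Q
    have h2 := hopt Q hQf
    have h3 := I.medianCost_le Q
    have h0 : 0 ≤ I.ccCost Q := add_nonneg (Nat.cast_nonneg _) (Nat.cast_nonneg _)
    have ht' : (1 : ℝ) ≤ t := by exact_mod_cast ht
    have h4 : (1 : ℝ) ≤ t * γ := one_le_mul_of_one_le_of_one_le ht' hγ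
    calc I.ccCost (s'.output I) ≤ 9 * I.ccCost Q + 170 * t * I.medianCost (s.output I) := h1
      _ ≤ 9 * I.ccCost Q + 170 * t * (γ * (2 * I.ccCost Q)) := by
          gcongr
          exact h2.trans (mul_le_mul_of_nonneg_left h3 (by linarith))
      _ = 9 * (1 * I.ccCost Q) + 340 * (t * γ) * I.ccCost Q := by ring
      _ ≤ 9 * ((t * γ) * I.ccCost Q) + 340 * (t * γ) * I.ccCost Q := by gcongr
      _ = 349 * (t * γ) * I.ccCost Q := by ring
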